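/- A logarithmic measure on a set $a$ is a function $\|\cdot\|\colon P(a)\setminus\{\emptyset\}\to\mathbb N$ such that $x\subseteq y$ implies $\|x\|\le\|y\|$, and whenever $x=x_1\cup x_2$ one has $\|x_i\|\ge\|x\|-1$ for some $i\in\{1,2\}$. Let $\mathcal{LT}$ be the set of pairs $(T,t)$ such that $T\subseteq{}^{<\omega}\omega$ is a tree (closed under initial segments) without terminal nodes which has a finite stem (a node of $T$ comparable with every node of $T$ and having at least two immediate successors in $T$), and $t$ is a function which assigns to each node $\eta\in T$ containing the stem a logarithmic measure $\|\cdot\|_\eta=t(\eta)$ on the set $\mathrm{succ}_T(\eta)$ of immediate successors of $\eta$ in $T$. (For $\eta$ a proper initial segment of the stem, put $\|\mathrm{succ}_T(\eta)\|_\eta=0$.) Order $\mathcal{LT}$ by $(T_2,t_2)\ge(T_1,t_1)$ (that is, $(T_2,t_2)$ is the stronger condition) iff $T_2\subseteq T_1$ and, for each $\eta\in T_2$ containing the stem of $T_2$, $t_2(\eta)$ is the restriction of $t_1(\eta)$ to the nonempty subsets of $\mathrm{succ}_{T_2}(\eta)$. Let $\mathcal{LT}^f_d$ be the set of all $(T,t)\in\mathcal{LT}$,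 with the induced order, such that every node of $T$ has only finitely many immediate successors in $T$ and, for every $m<\omega$, every infinite branch of $T$ is contained, up to finitely many nodes, in $$\{\eta\in T:\ \|\mathrm{succ}_T(\nu)\|_\nu\ge m\ \text{ for all }\nu\in T\text{ extending }\eta\}.$$ Proposition 1.18. The forcing notion $\mathcal{LT}^f_d$ is (1) ${}^\omega\omega$-bounding: it forces that every function from $\omega$ to $\omega$ in the generic extension is bounded (pointwise) by a function of the ground model; and (2) proper: writing $\mathbb P=(P,\le)$ for it, for every cardinal $\lambda$ such that the power set of $P$ is in $V_\lambda$, every countable elementary substructure $M$ of $(V_\lambda;\in,P,\le)$ with $\mathbb P\in M$, and every $p\in P\cap M$, there is $q\ge p$ in $P$ which is $M$-generic, i.e. for each $\mathbb P$-name $\dot\alpha\in M$ of an ordinal, $q\Vdash\dot\alpha\in M$. -/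

import Mathlib

universe u

namespace LTForcing

/-! ### Names and the forcing relation

A forcing notion is a preordered type `P` in which **larger conditions are stronger**. -/

section Forcing

variable {P : Type u}

/-- `P`-names: hereditarily, sets of pairs (name, condition). -/
inductive PName (P : Type u) : Type (u + 1)
  | mk (ι : Type u) (nm : ι → PName P) (cond : ι → P) : PName P

/-- The canonical name `x̌ = {(y̌, p) : y ∈ x, p ∈ P}` of a set of the ground model. -/
def PName.check (P : Type u) : PSet.{u} → PName P
  | ⟨α, A⟩ => ⟨α × P, fun x => PName.check P (A x.1), fun x => x.2⟩

/-- A name of the unordered pair `{σ, τ}`. -/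
def PName.upair (σ τ : PName P) : PName P :=
  ⟨ULift.{u} Bool × P, fun x => bif x.1.down then σ else τ, fun x => x.2⟩

/-- A name of the (Kuratowski) ordered pair `(σ, τ) = {{σ}, {σ, τ}}`. -/
def PName.opair (σ τ : PName P) : PName P :=
  PName.upair (PName.upair σ σ) (PName.upair σ τ)

/-- The canonical name of a natural number. -/
def PName.nat (P : Type u) (n : ℕ) : PName P := PName.check P (PSet.ofNat n)

/-- The canonical name of an ordinal. -/
noncomputable def PName.ord (P : Type u) (β : Ordinal.{u}) : PName P :=
  PName.check P β.toPSet

variable [Preorder P]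

/-- `ForcesEq σ τ p` is `p ⊩ σ = τ`: for every pair `(σ', s)` in `σ` and every `q ≥ p, s`, one has
`q ⊩ σ' ∈ τ`, and symmetrically. -/
def ForcesEq : PName P → PName P → P → Prop
  | ⟨ι, a, s⟩, ⟨κ, b, t⟩ => fun p =>
    (∀ i : ι, ∀ q, p ≤ q → s i ≤ q → ∀ q', q ≤ q' →
      ∃ r, q' ≤ r ∧ ∃ j : κ, t j ≤ r ∧ ForcesEq (a i) (b j) r) ∧
    (∀ j : κ, ∀ q, p ≤ q → t j ≤ q → ∀ q', q ≤ q' →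
      ∃ r, q' ≤ r ∧ ∃ i : ι, s i ≤ r ∧ ForcesEq (a i) (b j) r)

/-- `ForcesMem σ τ p` is `p ⊩ σ ∈ τ`: densely above `p` there is `r` such that for some
`(τ', t)` in `τ` one has `r ≥ t` and `r ⊩ σ = τ'`. -/
def ForcesMem (σ : PName P) : PName P → P → Prop
  | ⟨κ, b, t⟩ => fun p =>
    ∀ q, p ≤ q → ∃ r, q ≤ r ∧ ∃ j : κ, t j ≤ r ∧ ForcesEq σ (b j) r

/-- `p ⊩ "f is a function from ω to ω"`: every member of `f` is a pair of natural numbers, `f` is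
defined at every natural number, and `f` is single-valued. -/
def ForcesReal (f : PName P) (p : P) : Prop :=
  (∀ (σ : PName P) (q : P), p ≤ q → ForcesMem σ f q →
    ∃ r, q ≤ r ∧ ∃ m n : ℕ, ForcesEq σ (PName.opair (PName.nat P m) (PName.nat P n)) r) ∧
  (∀ (m : ℕ) (q : P), p ≤ q →
    ∃ r, q ≤ r ∧ ∃ n : ℕ, ForcesMem (PName.opair (PName.nat P m) (PName.nat P n)) f r) ∧
  (∀ (m n n' : ℕ) (q : P), p ≤ q →
    ForcesMem (PName.opair (PName.nat P m) (PName.nat P n)) f q →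
    ForcesMem (PName.opair (PName.nat P m) (PName.nat P n')) f q → n = n')

/-- `p ⊩ "f(m) ≤ g(m) for all m"`, where `g` is a function of the ground model (and `f` is forced to
be a function on `ω`). -/
def ForcesBounded (f : PName P) (g : ℕ → ℕ) (p : P) : Prop :=
  ∀ (m n : ℕ) (q : P), p ≤ q →
    ForcesMem (PName.opair (PName.nat P m) (PName.nat P n)) f q → n ≤ g m

/-- `P` forces every function in `^ω ω` of the generic extension to be bounded by one of the ground
model. -/
def IsOmegaOmegaBounding (P : Type u) [Preorder P] : Prop :=
  ∀ (f : PName P) (p : P), ForcesReal f p → ∃ q, p ≤ q ∧ ∃ g : ℕ → ℕ, ForcesBounded f g q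

/-! ### Proper forcing -/

/-- `τ` is a name of an ordinal: densely often, `τ` is forced to be equal to some ordinal (which may
be taken in the ground model, as forcing adds no ordinals). -/
def PName.IsOrdinalName (τ : PName P) : Prop :=
  ∀ p : P, ∃ q, p ≤ q ∧ ∃ β : Ordinal.{u}, ForcesEq τ (PName.ord P β) q

/-- `p ⊩ "τ ∈ M"`, for a name `τ` of an ordinal and a set `M` of the ground model. -/
def ForcesOrdMem (τ : PName P) (M : Set ZFSet.{u}) (p : P) : Prop :=
  ∀ q, p ≤ q → ∃ r, q ≤ r ∧ ∃ β : Ordinal.{u}, β.toZFSet ∈ M ∧ ForcesEq τ (PName.ord P β) r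

end Forcing

section Proper

/-! The conditions are coded as sets by an injection `c : P → ZFSet`, so that the forcing notion
becomes a poset in the universe of sets. -/

variable {P : Type u}

/-- The set which is coded by a name. -/
noncomputable def PName.toZFSet (c : P → ZFSet.{u}) : PName P → ZFSet.{u}
  | ⟨_, nm, cond⟩ => ZFSet.range fun i => ZFSet.pair (PName.toZFSet c (nm i)) (c (cond i))

/-- The underlying set of the coded forcing notion. -/
noncomputable def condSet (c : P → ZFSet.{u}) : ZFSet.{u} := ZFSet.range c

/-- The order relation of the coded forcing notion, as a set of pairs. -/
noncomputable def leSet [Preorder P] (c : P → ZFSet.{u}) : ZFSet.{u} :=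
  ZFSet.range fun x : {x : P × P // x.1 ≤ x.2} => ZFSet.pair (c x.1.1) (c x.1.2)

/-- A cardinal `κ` is large for the forcing notion if the power set of (the set of conditions of)
the forcing notion is in `V_κ`. -/
def IsLargeFor (c : P → ZFSet.{u}) (κ : Cardinal.{u}) : Prop :=
  ZFSet.powerset (condSet c) ∈ ZFSet.vonNeumann κ.ord

/-- The relation symbols `∈`, `P`, `≤`. -/
inductive ForcingRel : ℕ → Type
  | mem : ForcingRel 2
  | cond : ForcingRel 1
  | le : ForcingRel 2

/-- The first-order language with the symbols `∈`, `P`, `≤`. -/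
def forcingLanguage : FirstOrder.Language := ⟨fun _ => Empty, ForcingRel⟩

/-- The carrier of the structure `(V_κ; ∈, P, ≤)`. -/
def VModel (_c : P → ZFSet.{u}) (κ : Cardinal.{u}) : Type (u + 1) :=
  {x : ZFSet.{u} // x ∈ ZFSet.vonNeumann κ.ord}

instance [Preorder P] (c : P → ZFSet.{u}) (κ : Cardinal.{u}) :
    forcingLanguage.Structure (VModel c κ) where
  funMap := fun f _ => Empty.elim f
  RelMap := fun r x =>
    match r, x with
    | ForcingRel.mem, x => (x 0).1 ∈ (x 1).1
    | ForcingRel.cond, x => (x 0).1 ∈ condSet c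
    | ForcingRel.le, x => ZFSet.pair (x 0).1 (x 1).1 ∈ leSet c

/-- `q` is `M`-generic: for each name `τ` of an ordinal with `τ ∈ M`, `q ⊩ "τ ∈ M"`. -/
def IsGenericFor [Preorder P] (c : P → ZFSet.{u}) (M : Set ZFSet.{u}) (q : P) : Prop :=
  ∀ τ : PName P, τ.IsOrdinalName → τ.toZFSet c ∈ M → ForcesOrdMem τ M q

/-- `P` is proper: (for every copy of `P` in the universe of sets) for all cardinals `κ` that are
large for `P` and all countable elementary substructures `M` of `(V_κ; ∈, P, ≤)` with `(P, ≤) ∈ M`,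
each `p ∈ P ∩ M` has an `M`-generic extension. -/
def IsProperForcing (P : Type u) [Preorder P] : Prop :=
  ∀ c : P → ZFSet.{u}, Function.Injective c →
  ∀ κ : Cardinal.{u}, IsLargeFor c κ →
  ∀ N : forcingLanguage.ElementarySubstructure (VModel c κ), Countable N →
  ∀ M : Set ZFSet.{u}, M = Subtype.val '' (N : Set (VModel c κ)) →
  ZFSet.pair (condSet c) (leSet c) ∈ M →
  ∀ p : P, c p ∈ M → ∃ q, p ≤ q ∧ IsGenericFor c M q

end Proper

/-! ### Trees with logarithmic measures -/

/-- A logarithmic measure on `a`; only the values at nonempty subsets of `a` matter. -/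
structure IsLogMeasure (a : Set ℕ) (μ : Set ℕ → ℕ) : Prop where
  mono : ∀ x y : Set ℕ, x.Nonempty → x ⊆ y → y ⊆ a → μ x ≤ μ y
  split : ∀ x y : Set ℕ, x.Nonempty → y.Nonempty → x ⊆ a → y ⊆ a →
    μ (x ∪ y) ≤ μ x + 1 ∨ μ (x ∪ y) ≤ μ y + 1

/-- The successors of the node `η` in `T`; the successor `η⌢n` is represented by `n`. -/
def succs (T : Set (List ℕ)) (η : List ℕ) : Set ℕ := {n | η ++ [n] ∈ T}

/-- `s` is the stem of `T`: all nodes of `T` are comparable with `s`, and `T` ramifies at `s`. -/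
def IsStem (T : Set (List ℕ)) (s : List ℕ) : Prop :=
  s ∈ T ∧ (∀ η ∈ T, η <+: s ∨ s <+: η) ∧ (succs T s).Nontrivial

/-- The essential part of `T`: the nodes of `T` which contain the whole stem. -/
def ess (T : Set (List ℕ)) : Set (List ℕ) := {η | η ∈ T ∧ ∃ s, IsStem T s ∧ s <+: η}

/-- The pairs `(T, t)` where `T` is a subtree of `^{<ω} ω` with a finite stem and without terminal
nodes, and `t` assigns to each `η` in the essential part of `T` a logarithmic measure on the set of
successors of `η` in `T`. Outside its domain, `t` is given the value `0`. -/
@[ext]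
structure LT where
  tree : Set (List ℕ)
  meas : List ℕ → Set ℕ → ℕ
  prefix_closed : ∀ η ν : List ℕ, ν ∈ tree → η <+: ν → η ∈ tree
  succs_nonempty : ∀ η ∈ tree, (succs tree η).Nonempty
  exists_stem : ∃ s, IsStem tree s
  isLogMeasure : ∀ η ∈ ess tree, IsLogMeasure (succs tree η) (meas η)
  meas_eq_zero : ∀ (η : List ℕ) (S : Set ℕ),
    ¬ (η ∈ ess tree ∧ S.Nonempty ∧ S ⊆ succs tree η) → meas η S = 0

theorem ess_subset_ess {T₁ T₂ : Set (List ℕ)} (h : T₂ ⊆ T₁) (h₁ : ∃ s, IsStem T₁ s) :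
    ess T₂ ⊆ ess T₁ := by
  rintro η ⟨hη, s, ⟨hs, -, m, hm, n, hn, hmn⟩, hsη⟩
  obtain ⟨s₁, hs₁⟩ := h₁
  refine ⟨h hη, s₁, hs₁, ?_⟩
  have key : ∀ k, k ∈ succs T₂ s → ¬ s₁ <+: s → s ++ [k] <+: s₁ := by
    intro k hk hns
    rcases hs₁.2.1 _ (h hk) with h' | h'
    · exact h'
    · rcases List.prefix_concat_iff.1 h' with h'' | h''
      · rw [h'']
      · exact absurd h'' hns
  by_cases hc : s₁ <+: s
  · exact hc.trans hsη
  · have h1 := key m hm hc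
    have h2 := key n hn hc
    have h3 := List.prefix_of_prefix_length_le h1 h2 (by simp)
    have h4 := h3.eq_of_length (by simp)
    simp at h4
    exact absurd h4 hmn

/-- `p ≤ q` (`q` is stronger than `p`) iff the tree of `q` is contained in the tree of `p` and the
measures of `q` are the restrictions of those of `p`. -/
instance : PartialOrder LT where
  le p q := q.tree ⊆ p.tree ∧ ∀ η ∈ ess q.tree, ∀ S : Set ℕ, S.Nonempty →
    S ⊆ succs q.tree η → q.meas η S = p.meas η S
  le_refl p := ⟨subset_rfl, fun _ _ _ _ _ => rfl⟩
  le_trans p q r hpq hqr := ⟨hqr.1.trans hpq.1, fun η hη S hS hSs =>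
    (hqr.2 η hη S hS hSs).trans (hpq.2 η (ess_subset_ess hqr.1 q.exists_stem hη) S hS
      (hSs.trans fun _ hn => hqr.1 hn))⟩
  le_antisymm p q hpq hqp := by
    have hT : p.tree = q.tree := hqp.1.antisymm hpq.1
    refine LT.ext hT (funext fun η => funext fun S => ?_)
    by_cases hc : η ∈ ess p.tree ∧ S.Nonempty ∧ S ⊆ succs p.tree η
    · exact hqp.2 η hc.1 S hc.2.1 hc.2.2
    · rw [p.meas_eq_zero η S hc, q.meas_eq_zero η S (hT ▸ hc)]

namespace LT

/-- The measure `‖succ_T(η)‖_η` of the set of all successors of `η`; it is `0` when `η` is a proper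
initial segment of the stem. -/
def norm (p : LT) (η : List ℕ) : ℕ := p.meas η (succs p.tree η)

/-- Finite ramification at each node. -/
def FinitelyBranching (p : LT) : Prop := ∀ η ∈ p.tree, (succs p.tree η).Finite

/-- For any `m`, every branch of `T` is almost contained in the set of all `η ∈ T` such that
`‖succ_T(ν)‖_ν ≥ m` for all `ν ∈ T` extending `η`. -/
def Divergent (p : LT) : Prop :=
  ∀ (m : ℕ) (x : ℕ → ℕ), (∀ k, (List.range k).map x ∈ p.tree) →
    ({η | ∃ k, η = (List.range k).map x} \
      {η | η ∈ p.tree ∧ ∀ ν ∈ p.tree, η <+: ν → m ≤ p.norm ν}).Finite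

end LT

/-- The forcing notion `LT^f_d`, with the order induced from `LT`. -/
abbrev LTfd : Type := {p : LT // p.FinitelyBranching ∧ p.Divergent}

end LTForcing

/-! Both properties follow from fusion along finite fronts. Suppose that from any condition one can
start a fusion, that each step can move a finite front into a given dense open set, and that the
steps have a limit above which all the fronts are predense. For bounding, let the m-th front decide
the value at m; only finitely many values are then possible. For properness, run the fusion with
states chosen in M, meeting each dense open set of M. The fronts are finite and belong to M as
sections of a relation in M, so all their members are in M. A member of M that decides a name in M
gives it a value in M, by elementarity.

To carry this out in (V_κ; ∈, P, ≤), the notion of front system is first-order: finiteness is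
Tarski's, limits are required for chains given as sets, and states are indexed by conditions. By
elementarity some front system lies in M (`VModel.exists_generic`). The relation "p forces τ to be a
given ordinal" is first-order through set-sized tables (`VModel.forcesCheck_iff`).

The front system of the trees rests on pure decision (`exists_pure_extension`). Call a node good if
the tree above it can be thinned out, keeping norms at least n, so that its restrictions to all
sufficiently high nodes lie in D. If a node is bad, its good successors have measure below n, so the
bad ones lose at most 1 from the norm. The bad nodes would then form a condition, and an extension
of it in D yields a good node among them. By finite branching the decision happens at a fixed level,
whose restrictions form the finite front; the intersection of a fusion sequence still has norms
tending to infinity.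

One obstacle remains. Singletons may have large measure, so a subtree with diverging norms may be a
single branch, which has no stem and is no condition. Two such branches together form a maximal
condition, for which everything is trivial; with at most one such branch, some cone contains none
(`exists_isMax_or_isRich`), and there the fusion works. -/

namespace LTForcing

/-! ### Fusion along finite fronts, and bounding. -/

section Forcing

variable {P : Type u} [Preorder P]

theorem ForcesEq.mono {σ τ : PName P} {p q : P} (h : ForcesEq σ τ p) (hpq : p ≤ q) :
    ForcesEq σ τ q := by
  cases σ; cases τ
  rw [ForcesEq] at h ⊢
  exact ⟨fun i r hr => h.1 i r (hpq.trans hr), fun j r hr => h.2 j r (hpq.trans hr)⟩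

theorem ForcesMem.mono {σ τ : PName P} {p q : P} (h : ForcesMem σ τ p) (hpq : p ≤ q) :
    ForcesMem σ τ q := by
  cases τ
  rw [ForcesMem] at h ⊢
  exact fun r hr => h r (hpq.trans hr)

/-- A dense subset of a forcing notion which is closed under passing to stronger conditions. -/
structure IsDenseOpen (D : Set P) : Prop where
  dense : ∀ p, ∃ q ∈ D, p ≤ q
  isOpen : ∀ p ∈ D, ∀ q, p ≤ q → q ∈ D

/-- A system of finite fronts that allows fusion: any state can be moved, within the relation `rel`,
to one whose front meets a prescribed dense open set, and each chain of states has a condition above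
which all its fronts are predense. -/
structure FrontSystem (P : Type u) [Preorder P] (S : Type u) where
  front : S → Set P
  rel : S → S → Prop
  finite_front : ∀ s, (front s).Finite
  rel_refl : ∀ s s', rel s s' → rel s' s'
  rel_trans : ∀ s s' s'', rel s s' → rel s' s'' → rel s s''
  exists_start : ∀ p, ∃ s, rel s s ∧ ∀ d ∈ front s, p ≤ d
  exists_step : ∀ s, rel s s → ∀ D : Set P, IsDenseOpen D → ∃ s', rel s s' ∧ front s' ⊆ D
  exists_limit : ∀ C : Set S, C.Nonempty → (∀ s ∈ C, ∀ s' ∈ C, rel s s' ∨ rel s' s) →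
    ∃ q, ∀ s ∈ C, ∀ r, q ≤ r → ∃ d ∈ front s, ∃ t, r ≤ t ∧ d ≤ t

namespace FrontSystem

variable {S : Type u}

/-- Iterate `exists_step` along the sequence of dense sets; the states form a chain, and its limit
keeps every front predense. -/
theorem exists_generic (F : FrontSystem P S) (p : P) (D : ℕ → Set P)
    (hD : ∀ n, IsDenseOpen (D n)) :
    ∃ (A : ℕ → Set P) (q : P), p ≤ q ∧ ∀ n, (A n).Finite ∧ A n ⊆ D n ∧
      ∀ r, q ≤ r → ∃ d ∈ A n, ∃ t, r ≤ t ∧ d ≤ t := by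
  obtain ⟨s₀, hs₀, hps₀⟩ := F.exists_start p
  have step : ∀ n (s : {s // F.rel s s}), ∃ s' : {s // F.rel s s},
      F.rel s s' ∧ F.front s' ⊆ D n := fun n s => by
    obtain ⟨s', h, h'⟩ := F.exists_step s.1 s.2 (D n) (hD n)
    exact ⟨⟨s', F.rel_refl _ _ h⟩, h, h'⟩
  choose g hg hgD using step
  let x : ℕ → {s // F.rel s s} := fun n => Nat.rec ⟨s₀, hs₀⟩ g n
  have hx : ∀ m n, m ≤ n → F.rel (x m).1 (x n).1 := by
    intro m n h
    induction h with
    | refl => exact (x m).2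
    | step _ ih => exact F.rel_trans _ _ _ ih (hg _ _)
  obtain ⟨q, hq⟩ := F.exists_limit (Set.range fun n => (x n).1) ⟨_, 0, rfl⟩ (by
    rintro _ ⟨m, rfl⟩ _ ⟨n, rfl⟩
    exact (le_total m n).imp (hx _ _) (hx _ _))
  -- The limit `q` need not extend `p`. It is compatible with a member of the first front, all of
  -- which extend `p`, so a common extension serves as the generic condition.
  obtain ⟨d, hd, t, hqt, hdt⟩ := hq (x 0).1 ⟨0, rfl⟩ q le_rfl
  refine ⟨fun n => F.front (x (n + 1)).1, t, (hps₀ d hd).trans hdt, fun n =>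
    ⟨F.finite_front _, hgD _ _, fun r hr => hq _ ⟨n + 1, rfl⟩ r (hqt.trans hr)⟩⟩

/-- A finite front deciding the value at `m` leaves finitely many possibilities, and their maximum
is the bound. -/
theorem isOmegaOmegaBounding (F : FrontSystem P S) : IsOmegaOmegaBounding P := by
  intro f p hf
  let val (m n : ℕ) (r : P) : Prop :=
    ForcesMem (PName.opair (PName.nat P m) (PName.nat P n)) f r
  -- `f` names a function only below `p`, so conditions incompatible with `p` are added to make the
  -- set dense.
  let D (m : ℕ) : Set P := {r | (p ≤ r ∧ ∃ n, val m n r) ∨ ∀ s, r ≤ s → ¬ p ≤ s}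
  have hD : ∀ m, IsDenseOpen (D m) := fun m => by
    refine ⟨fun r => ?_, ?_⟩
    · by_cases h : ∃ s, r ≤ s ∧ p ≤ s
      · obtain ⟨s, hrs, hps⟩ := h
        obtain ⟨t, hst, n, hn⟩ := hf.2.1 m s hps
        exact ⟨t, Or.inl ⟨hps.trans hst, n, hn⟩, hrs.trans hst⟩
      · exact ⟨r, Or.inr fun s hrs hps => h ⟨s, hrs, hps⟩, le_rfl⟩
    · rintro r (⟨hpr, n, hn⟩ | h) s hrs
      · exact Or.inl ⟨hpr.trans hrs, n, ForcesMem.mono hn hrs⟩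
      · exact Or.inr fun t hst => h t (hrs.trans hst)
  obtain ⟨A, q, hpq, hA⟩ := F.exists_generic p D hD
  have bound : ∀ m, ∃ b, ∀ d ∈ A m, p ≤ d → ∀ n, val m n d → n ≤ b := by
    intro m
    have : ∀ d, ∃ b, p ≤ d → ∀ n, val m n d → n ≤ b := fun d => by
      by_cases h : p ≤ d ∧ ∃ n, val m n d
      · obtain ⟨hpd, n, hn⟩ := h
        exact ⟨n, fun _ n' hn' => (hf.2.2 m n' n d hpd hn' hn).le⟩
      · exact ⟨0, fun hpd n hn => absurd ⟨hpd, n, hn⟩ h⟩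
    choose b hb using this
    obtain ⟨B, hB⟩ := ((hA m).1.image b).bddAbove
    exact ⟨B, fun d hd hpd n hn => (hb d hpd n hn).trans (hB ⟨d, hd, rfl⟩)⟩
  choose g hg using bound
  refine ⟨q, hpq, g, fun m n r hr hn => ?_⟩
  obtain ⟨d, hd, t, hrt, hdt⟩ := (hA m).2.2 r hr
  have hpt : p ≤ t := hpq.trans (hr.trans hrt)
  rcases (hA m).2.1 hd with ⟨hpd, n', hn'⟩ | h
  · have : n = n' := hf.2.2 m n n' t hpt (ForcesMem.mono hn hrt) (ForcesMem.mono hn' hdt)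
    exact this ▸ hg m d hd hpd n' hn'
  · exact absurd hpt (h t hdt)

/-- Reindexing of the states. -/
def reindex {S' : Type u} (F : FrontSystem P S) (e : S' ≃ S) : FrontSystem P S' where
  front s := F.front (e s)
  rel s s' := F.rel (e s) (e s')
  finite_front s := F.finite_front (e s)
  rel_refl s s' := F.rel_refl (e s) (e s')
  rel_trans s s' s'' := F.rel_trans (e s) (e s') (e s'')
  exists_start p := e.surjective.exists.1 (F.exists_start p)
  exists_step s hs D hD := e.surjective.exists.1 (F.exists_step (e s) hs D hD)
  exists_limit C hC h := by
    obtain ⟨q, hq⟩ := F.exists_limit (e '' C) (hC.image e) (by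
      rintro _ ⟨s, hs, rfl⟩ _ ⟨s', hs', rfl⟩
      exact h s hs s' hs')
    exact ⟨q, fun s hs => hq (e s) ⟨s, hs, rfl⟩⟩

end FrontSystem

end Forcing

/-! ### Definability with parameters in an elementary substructure. -/

section Definability

open FirstOrder FirstOrder.Language

variable {L : FirstOrder.Language} {V : Type*} [L.Structure V] (N : L.ElementarySubstructure V)

/-- A relation is first-order definable with parameters from `N`. -/
def Dfn {n : ℕ} (R : (Fin n → V) → Prop) : Prop :=
  ∃ φ : L.BoundedFormula N n, ∀ xs : Fin n → V, φ.Realize (Subtype.val : N → V) xs ↔ R xs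

/-- A function of several variables which is the value of a term with parameters from `N`. -/
def Tm {n : ℕ} (t : (Fin n → V) → V) : Prop :=
  ∃ u : L.Term (N ⊕ Fin n), ∀ xs : Fin n → V, u.realize (Sum.elim (Subtype.val : N → V) xs) = t xs

variable {N} {n : ℕ}

theorem Tm.var (i : Fin n) : Tm N (fun xs => xs i) := ⟨Term.var (Sum.inr i), fun _ => rfl⟩

theorem Tm.const {a : V} (ha : a ∈ N) : Tm N (fun _ : Fin n → V => a) :=
  ⟨Term.var (Sum.inl ⟨a, ha⟩), fun _ => rfl⟩

theorem Tm.reindex {m : ℕ} {t : (Fin n → V) → V} (ht : Tm N t) (g : Fin n → Fin m) :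
    Tm N (fun xs : Fin m → V => t fun i => xs (g i)) := by
  obtain ⟨u, hu⟩ := ht
  refine ⟨u.relabel (Sum.map id g), fun xs => ?_⟩
  rw [Term.realize_relabel]
  refine Eq.trans ?_ (hu _)
  congr 1
  funext x
  cases x <;> rfl

theorem Tm.weaken {t : (Fin n → V) → V} (ht : Tm N t) :
    Tm N (fun xs : Fin (n + 1) → V => t fun i => xs i.castSucc) := ht.reindex _

theorem Dfn.eq {s t : (Fin n → V) → V} (hs : Tm N s) (ht : Tm N t) :
    Dfn N (fun xs => s xs = t xs) := by
  obtain ⟨u, hu⟩ := hs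
  obtain ⟨v, hv⟩ := ht
  exact ⟨u.bdEqual v, fun xs => by rw [BoundedFormula.realize_bdEqual, hu, hv]⟩

theorem Dfn.rel₁ (r : L.Relations 1) {s : (Fin n → V) → V} (hs : Tm N s) :
    Dfn N (fun xs => Structure.RelMap r ![s xs]) := by
  obtain ⟨u, hu⟩ := hs
  exact ⟨r.boundedFormula₁ u, fun xs => by rw [BoundedFormula.realize_rel₁, hu]⟩

theorem Dfn.rel₂ (r : L.Relations 2) {s t : (Fin n → V) → V} (hs : Tm N s) (ht : Tm N t) :
    Dfn N (fun xs => Structure.RelMap r ![s xs, t xs]) := by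
  obtain ⟨u, hu⟩ := hs
  obtain ⟨v, hv⟩ := ht
  exact ⟨r.boundedFormula₂ u v, fun xs => by rw [BoundedFormula.realize_rel₂, hu, hv]⟩

theorem Dfn.not {R : (Fin n → V) → Prop} (hR : Dfn N R) : Dfn N (fun xs => ¬ R xs) := by
  obtain ⟨φ, hφ⟩ := hR
  exact ⟨φ.not, fun xs => by rw [BoundedFormula.realize_not, hφ]⟩

theorem Dfn.and {R S : (Fin n → V) → Prop} (hR : Dfn N R) (hS : Dfn N S) :
    Dfn N (fun xs => R xs ∧ S xs) := by
  obtain ⟨φ, hφ⟩ := hR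
  obtain ⟨ψ, hψ⟩ := hS
  exact ⟨φ ⊓ ψ, fun xs => by rw [BoundedFormula.realize_inf, hφ, hψ]⟩

theorem Dfn.or {R S : (Fin n → V) → Prop} (hR : Dfn N R) (hS : Dfn N S) :
    Dfn N (fun xs => R xs ∨ S xs) := by
  obtain ⟨φ, hφ⟩ := hR
  obtain ⟨ψ, hψ⟩ := hS
  exact ⟨φ ⊔ ψ, fun xs => by rw [BoundedFormula.realize_sup, hφ, hψ]⟩

theorem Dfn.imp {R S : (Fin n → V) → Prop} (hR : Dfn N R) (hS : Dfn N S) :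
    Dfn N (fun xs => R xs → S xs) := by
  obtain ⟨φ, hφ⟩ := hR
  obtain ⟨ψ, hψ⟩ := hS
  exact ⟨φ.imp ψ, fun xs => by rw [BoundedFormula.realize_imp, hφ, hψ]⟩

theorem Dfn.iff {R S : (Fin n → V) → Prop} (hR : Dfn N R) (hS : Dfn N S) :
    Dfn N (fun xs => R xs ↔ S xs) := by
  simpa only [iff_iff_implies_and_implies] using (hR.imp hS).and (hS.imp hR)

theorem Dfn.all {R : (Fin n → V) → V → Prop}
    (hR : Dfn N (fun xs : Fin (n + 1) → V => R (fun i => xs i.castSucc) (xs (Fin.last n)))) :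
    Dfn N (fun xs => ∀ x, R xs x) := by
  obtain ⟨φ, hφ⟩ := hR
  exact ⟨φ.all, fun xs => by simp [hφ]⟩

theorem Dfn.ex {R : (Fin n → V) → V → Prop}
    (hR : Dfn N (fun xs : Fin (n + 1) → V => R (fun i => xs i.castSucc) (xs (Fin.last n)))) :
    Dfn N (fun xs => ∃ x, R xs x) := by
  obtain ⟨φ, hφ⟩ := hR
  exact ⟨φ.ex, fun xs => by simp [hφ]⟩

/-- The Tarski-Vaught criterion. -/
theorem Dfn.exists_mem {R : V → Prop} (hR : Dfn N (fun xs : Fin 1 → V => R (xs 0)))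
    (h : ∃ x, R x) : ∃ x ∈ N, R x := by
  obtain ⟨φ, hφ⟩ := hR
  have h1 : φ.ex.Realize (N.subtype ∘ id) (N.subtype ∘ (default : Fin 0 → N)) := by
    rw [BoundedFormula.realize_ex]
    obtain ⟨x, hx⟩ := h
    exact ⟨x, (hφ _).2 (by simpa [Fin.snoc] using hx)⟩
  rw [N.subtype.map_boundedFormula, BoundedFormula.realize_ex] at h1
  obtain ⟨x, hx⟩ := h1
  refine ⟨x, x.2, ?_⟩
  rw [← N.subtype.map_boundedFormula] at hx
  have := (hφ _).1 hx
  simpa [Fin.snoc] using this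

/-- If some solution were outside `N`, the formula "a solution different from each of the finitely
many solutions in `N`" would have parameters in `N` and be satisfiable, hence satisfied in `N`,
which is absurd. -/
theorem Dfn.mem_of_finite {R : V → Prop} (hR : Dfn N (fun xs : Fin 1 → V => R (xs 0)))
    (hfin : {x | R x}.Finite) {x : V} (hx : R x) : x ∈ N := by
  by_contra hxN
  have key : ∀ s : Set V, s.Finite → s ⊆ N →
      Dfn N (fun xs : Fin 1 → V => R (xs 0) ∧ ∀ y ∈ s, xs 0 ≠ y) := by
    intro s hs
    induction s, hs using Set.Finite.induction_on with
    | empty => exact fun _ => by simpa using hR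
    | @insert a s _ _ ih =>
      intro h
      have := (ih ((Set.subset_insert _ _).trans h)).and
        (Dfn.not (Dfn.eq (Tm.var 0) (Tm.const (h (Set.mem_insert a s)))))
      convert! this using 2
      simp only [Set.mem_insert_iff, forall_eq_or_imp]
      tauto
  obtain ⟨y, hyN, hy, hys⟩ := Dfn.exists_mem
    (R := fun x => R x ∧ ∀ y ∈ {x | R x} ∩ (N : Set V), x ≠ y)
    (key ({x | R x} ∩ N) (hfin.subset Set.inter_subset_left) Set.inter_subset_right)
    ⟨x, hx, fun y hy h => hxN (h ▸ hy.2)⟩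
  exact hys y ⟨hy, hyN⟩ rfl

end Definability

/-! ### First-order descriptions of fronts and forcing in V_κ. -/

namespace VModel

variable {P : Type u} {c : P → ZFSet.{u}} {κ : Cardinal.{u}}

/-- Membership in `V_κ`. -/
def Mem (x y : VModel c κ) : Prop := x.1 ∈ y.1

/-- `x` is (the code of) a condition. -/
def Cond (x : VModel c κ) : Prop := x.1 ∈ condSet c

/-- The order of the coded forcing notion. -/
def Le [Preorder P] (x y : VModel c κ) : Prop := ZFSet.pair x.1 y.1 ∈ leSet c

/-- `z` is the unordered pair of `x` and `y`. -/
def IsUPair (x y z : VModel c κ) : Prop := ∀ u, Mem u z ↔ u = x ∨ u = y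

/-- `z` is the ordered pair of `x` and `y`. -/
def IsPair (x y z : VModel c κ) : Prop := ∀ w, Mem w z ↔ IsUPair x x w ∨ IsUPair x y w

/-- The set `r` contains the pair of `x` and `y`. -/
def Rel (x y r : VModel c κ) : Prop := ∃ z, IsPair x y z ∧ Mem z r

/-- The set `r` contains the triple of `x`, `y` and `z`. -/
def Rel₃ (x y z r : VModel c κ) : Prop := ∃ w, IsPair y z w ∧ Rel x w r

/-- `x` is a von Neumann ordinal. -/
def IsOrd (x : VModel c κ) : Prop :=
  (∀ y, Mem y x → ∀ z, Mem z y → Mem z x) ∧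
  ∀ y, Mem y x → ∀ z, Mem z y → ∀ w, Mem w z → Mem w y

/-- `D` is a dense open set of conditions. -/
def IsDenseOpen [Preorder P] (D : VModel c κ) : Prop :=
  (∀ p, Cond p → ∃ q, Mem q D ∧ Le p q) ∧ ∀ p, Mem p D → ∀ q, Le p q → Mem q D

/-- The set of all `d` with `(s, d) ∈ Fr` is finite in the sense of Tarski. -/
def FinSection (Fr s : VModel c κ) : Prop :=
  ∀ A, (∃ a, Mem a A) → (∀ a, Mem a A → ∀ d, Mem d a → Rel s d Fr) →
    ∃ a, Mem a A ∧ ∀ b, Mem b A → (∀ d, Mem d b → Mem d a) → ∀ d, Mem d a → Mem d b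

/-- The sets of pairs `R` and `Fr` code a system of finite fronts. -/
def IsFrontSystem [Preorder P] (R Fr : VModel c κ) : Prop :=
  (∀ s, FinSection Fr s) ∧
  (∀ s s', Rel s s' R → Rel s' s' R) ∧
  (∀ s s' s'', Rel s s' R → Rel s' s'' R → Rel s s'' R) ∧
  (∀ p, Cond p → ∃ s, Rel s s R ∧ ∀ d, Rel s d Fr → Le p d) ∧
  (∀ s, Rel s s R → ∀ D, IsDenseOpen D → ∃ s', Rel s s' R ∧ ∀ d, Rel s' d Fr → Mem d D) ∧
  ∀ C, (∃ s, Mem s C) → (∀ s, Mem s C → ∀ s', Mem s' C → Rel s s' R ∨ Rel s' s R) →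
    ∃ q, Cond q ∧ ∀ s, Mem s C → ∀ r, Le q r → ∃ d, Rel s d Fr ∧ ∃ t, Le r t ∧ Le d t

/-- Each triple `(a, x, p)` in `B` satisfies the recursive clause of `p ⊩ a = x̌` relative to `B`. -/
def IsForcingTable [Preorder P] (B : VModel c κ) : Prop :=
  ∀ a x p, Rel₃ a x p B →
    (∀ b s, Rel b s a → ∀ q, Le p q → Le s q → ∃ r, Le q r ∧ ∃ y, Mem y x ∧ Rel₃ b y r B) ∧
    ∀ y, Mem y x → ∀ q, Le p q → ∃ r, Le q r ∧ ∃ b s, Rel b s a ∧ Le s r ∧ Rel₃ b y r B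

/-- The internal version of the relation `p ⊩ a = x̌`. -/
def ForcesCheck [Preorder P] (a x p : VModel c κ) : Prop := ∃ B, IsForcingTable B ∧ Rel₃ a x p B

section Definability

variable [Preorder P] {N : forcingLanguage.ElementarySubstructure (VModel c κ)} {n : ℕ}
  {s t u v : (Fin n → VModel c κ) → VModel c κ}

theorem dfn_mem (hs : Tm N s) (ht : Tm N t) : Dfn N (fun xs => Mem (s xs) (t xs)) :=
  Dfn.rel₂ (L := forcingLanguage) ForcingRel.mem hs ht

theorem dfn_cond (hs : Tm N s) : Dfn N (fun xs => Cond (s xs)) :=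
  Dfn.rel₁ (L := forcingLanguage) ForcingRel.cond hs

theorem dfn_le (hs : Tm N s) (ht : Tm N t) : Dfn N (fun xs => Le (s xs) (t xs)) :=
  Dfn.rel₂ (L := forcingLanguage) ForcingRel.le hs ht

theorem dfn_isUPair (hs : Tm N s) (ht : Tm N t) (hu : Tm N u) :
    Dfn N (fun xs => IsUPair (s xs) (t xs) (u xs)) :=
  Dfn.all (Dfn.iff (dfn_mem (Tm.var _) hu.weaken)
    (Dfn.or (Dfn.eq (Tm.var _) hs.weaken) (Dfn.eq (Tm.var _) ht.weaken)))

theorem dfn_isPair (hs : Tm N s) (ht : Tm N t) (hu : Tm N u) :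
    Dfn N (fun xs => IsPair (s xs) (t xs) (u xs)) :=
  Dfn.all (Dfn.iff (dfn_mem (Tm.var _) hu.weaken)
    (Dfn.or (dfn_isUPair hs.weaken hs.weaken (Tm.var _))
      (dfn_isUPair hs.weaken ht.weaken (Tm.var _))))

theorem dfn_rel (hs : Tm N s) (ht : Tm N t) (hu : Tm N u) :
    Dfn N (fun xs => Rel (s xs) (t xs) (u xs)) :=
  Dfn.ex (Dfn.and (dfn_isPair hs.weaken ht.weaken (Tm.var _)) (dfn_mem (Tm.var _) hu.weaken))

theorem dfn_rel₃ (hs : Tm N s) (ht : Tm N t) (hu : Tm N u) (hv : Tm N v) :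
    Dfn N (fun xs => Rel₃ (s xs) (t xs) (u xs) (v xs)) :=
  Dfn.ex (Dfn.and (dfn_isPair ht.weaken hu.weaken (Tm.var _))
    (dfn_rel hs.weaken (Tm.var _) hv.weaken))

theorem dfn_isOrd (hs : Tm N s) : Dfn N (fun xs => IsOrd (s xs)) := by
  unfold IsOrd
  -- The formula is read off the syntax. Under several quantifiers a parameter term has been
  -- weakened several times, and a single `reindex` absorbs all of them.
  repeat' first
    | exact hs.reindex _ | exact Tm.var _ | apply dfn_mem
    | apply Dfn.and | apply Dfn.imp | apply Dfn.all

theorem dfn_isDenseOpen (hs : Tm N s) : Dfn N (fun xs => IsDenseOpen (s xs)) := by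
  unfold IsDenseOpen
  repeat' first
    | exact hs.reindex _ | exact Tm.var _ | apply dfn_mem | apply dfn_le | apply dfn_cond
    | apply Dfn.and | apply Dfn.imp | apply Dfn.all | apply Dfn.ex

theorem dfn_finSection (hs : Tm N s) (ht : Tm N t) :
    Dfn N (fun xs => FinSection (s xs) (t xs)) := by
  unfold FinSection
  repeat' first
    | exact hs.reindex _ | exact ht.reindex _ | exact Tm.var _ | apply dfn_mem | apply dfn_rel
    | apply Dfn.and | apply Dfn.imp | apply Dfn.all | apply Dfn.ex

theorem dfn_isFrontSystem (hs : Tm N s) (ht : Tm N t) :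
    Dfn N (fun xs => IsFrontSystem (s xs) (t xs)) := by
  unfold IsFrontSystem
  repeat' first
    | exact hs.reindex _ | exact ht.reindex _ | exact Tm.var _ | apply dfn_mem | apply dfn_le
    | apply dfn_cond | apply dfn_rel | apply dfn_isDenseOpen | apply dfn_finSection
    | apply Dfn.and | apply Dfn.or | apply Dfn.imp | apply Dfn.all | apply Dfn.ex

theorem dfn_isForcingTable (hs : Tm N s) : Dfn N (fun xs => IsForcingTable (s xs)) := by
  unfold IsForcingTable
  repeat' first
    | exact hs.reindex _ | exact Tm.var _ | apply dfn_mem | apply dfn_le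
    | apply dfn_rel | apply dfn_rel₃
    | apply Dfn.and | apply Dfn.imp | apply Dfn.all | apply Dfn.ex

theorem dfn_forcesCheck (hs : Tm N s) (ht : Tm N t) (hu : Tm N u) :
    Dfn N (fun xs => ForcesCheck (s xs) (t xs) (u xs)) :=
  Dfn.ex (Dfn.and (dfn_isForcingTable (Tm.var _))
    (dfn_rel₃ hs.weaken ht.weaken hu.weaken (Tm.var _)))

end Definability

end VModel

/-! ### Ranks of pairs and of coded relations. -/

theorem rank_lt_rank_pair_left (x y : ZFSet.{u}) : x.rank < (ZFSet.pair x y).rank := by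
  rw [ZFSet.pair, ZFSet.rank_pair, ZFSet.rank_singleton]
  exact (Order.lt_succ _).trans ((Order.lt_succ _).trans_le (le_max_left _ _))

theorem rank_lt_rank_pair_right (x y : ZFSet.{u}) : y.rank < (ZFSet.pair x y).rank := by
  rw [ZFSet.pair, ZFSet.rank_pair, ZFSet.rank_pair]
  exact (Order.lt_succ _).trans_le ((le_max_right _ _).trans
    ((Order.le_succ _).trans (le_max_right _ _)))

theorem rank_pair_le {x y : ZFSet.{u}} {o : Ordinal.{u}} (hx : x.rank ≤ o) (hy : y.rank ≤ o) :
    (ZFSet.pair x y).rank ≤ Order.succ (Order.succ o) := by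
  rw [ZFSet.pair, ZFSet.rank_pair, ZFSet.rank_singleton, ZFSet.rank_pair]
  refine max_le ?_ ?_ <;> simp [hx, hy]

/-- The set of pairs that codes a binary relation on conditions. -/
noncomputable def relSet {P : Type u} (c : P → ZFSet.{u}) (r : P → P → Prop) : ZFSet.{u} :=
  ZFSet.range fun x : {x : P × P // r x.1 x.2} => ZFSet.pair (c x.1.1) (c x.1.2)

theorem mem_relSet {P : Type u} {c : P → ZFSet.{u}} {r : P → P → Prop} {z : ZFSet.{u}} :
    z ∈ relSet c r ↔ ∃ p q, r p q ∧ z = ZFSet.pair (c p) (c q) := by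
  simp only [relSet, ZFSet.mem_range, Subtype.exists, Prod.exists, exists_prop, eq_comm]

theorem rank_relSet_le {P : Type u} {c : P → ZFSet.{u}} {r : P → P → Prop} {o : Ordinal.{u}}
    (ho : (condSet c).rank ≤ o) : (relSet c r).rank ≤ Order.succ (Order.succ o) := by
  rw [ZFSet.rank_le_iff]
  intro z hz
  obtain ⟨p, q, -, rfl⟩ := mem_relSet.1 hz
  have h : ∀ p, Order.succ (c p).rank ≤ o := fun p =>
    Order.succ_le_of_lt ((ZFSet.rank_lt_of_mem (ZFSet.mem_range_self p)).trans_le ho)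
  rw [ZFSet.pair, ZFSet.rank_pair, ZFSet.rank_singleton, ZFSet.rank_pair, max_lt_iff]
  exact ⟨Order.succ_lt_succ (Order.lt_succ_of_le (h p)),
    Order.succ_lt_succ (Order.lt_succ_of_le (max_le (h p) (h q)))⟩

/-! ### Forcing equality with a ground model set. -/

section PName

variable {P : Type u} [Preorder P]

/-- In a check name every element occurs with every condition, so membership conditions on that side
can be taken equal to the current condition and disappear. -/
theorem forcesEq_check_mk_iff {ι : Type u} {nm : ι → PName P} {cond : ι → P} {α : Type u}
    {A : α → PSet.{u}} {p : P} :
    ForcesEq (PName.mk ι nm cond) (PName.check P ⟨α, A⟩) p ↔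
      (∀ i q, p ≤ q → cond i ≤ q → ∃ r, q ≤ r ∧ ∃ j, ForcesEq (nm i) (PName.check P (A j)) r) ∧
      ∀ j q, p ≤ q →
        ∃ r, q ≤ r ∧ ∃ i, cond i ≤ r ∧ ForcesEq (nm i) (PName.check P (A j)) r := by
  rw [PName.check, ForcesEq]
  constructor
  · rintro ⟨h1, h2⟩
    refine ⟨fun i q hq hi => ?_, fun j q hq => ?_⟩
    · obtain ⟨r, hr, j, -, h⟩ := h1 i q hq hi q le_rfl
      exact ⟨r, hr, j.1, h⟩
    · obtain ⟨r, hr, i, hi, h⟩ := h2 (j, q) q hq le_rfl q le_rfl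
      exact ⟨r, hr, i, hi, h⟩
  · rintro ⟨h1, h2⟩
    refine ⟨fun i q hq hi q' hq' => ?_, fun j q hq _ q' hq' => ?_⟩
    · obtain ⟨r, hr, j, h⟩ := h1 i q' (hq.trans hq') (hi.trans hq')
      exact ⟨r, hr, (j, r), le_rfl, h⟩
    · obtain ⟨r, hr, i, hi, h⟩ := h2 j.1 q' (hq.trans hq')
      exact ⟨r, hr, i, hi, h⟩

/-- Needed because a `ZFSet` determines its `PSet` representative only up to equivalence. -/
theorem ForcesEq.check_congr (τ : PName P) :
    ∀ (X Y : PSet.{u}) (p : P), PSet.Equiv X Y → ForcesEq τ (PName.check P X) p →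
      ForcesEq τ (PName.check P Y) p := by
  induction τ with
  | mk ι nm cond ih =>
    rintro ⟨α, A⟩ ⟨β, B⟩ p ⟨hAB, hBA⟩ h
    rw [forcesEq_check_mk_iff] at h ⊢
    refine ⟨fun i q hq hi => ?_, fun j q hq => ?_⟩
    · obtain ⟨r, hr, j, h⟩ := h.1 i q hq hi
      obtain ⟨k, hk⟩ := hAB j
      exact ⟨r, hr, k, ih i _ _ r hk h⟩
    · obtain ⟨k, hk⟩ := hBA j
      obtain ⟨r, hr, i, hi, h⟩ := h.2 k q hq
      exact ⟨r, hr, i, hi, ih i _ _ r hk h⟩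

theorem forcesEq_check_iff {ι : Type u} {nm : ι → PName P} {cond : ι → P} {X : PSet.{u}} {p : P} :
    ForcesEq (PName.mk ι nm cond) (PName.check P X) p ↔
      (∀ i q, p ≤ q → cond i ≤ q → ∃ r, q ≤ r ∧ ∃ Y ∈ X, ForcesEq (nm i) (PName.check P Y) r) ∧
      ∀ Y ∈ X, ∀ q, p ≤ q →
        ∃ r, q ≤ r ∧ ∃ i, cond i ≤ r ∧ ForcesEq (nm i) (PName.check P Y) r := by
  obtain ⟨α, A⟩ := X
  rw [forcesEq_check_mk_iff]
  refine and_congr (forall_congr' fun i => forall₃_congr fun q _ _ => ?_) ?_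
  · refine exists_congr fun r => and_congr_right fun _ => ?_
    constructor
    · rintro ⟨j, h⟩
      exact ⟨A j, PSet.Mem.mk A j, h⟩
    · rintro ⟨Y, ⟨j, hj⟩, h⟩
      exact ⟨j, h.check_congr _ _ _ r hj⟩
  · constructor
    · rintro h Y ⟨j, hj⟩ q hq
      obtain ⟨r, hr, i, hi, h⟩ := h j q hq
      exact ⟨r, hr, i, hi, h.check_congr _ _ _ r hj.symm⟩
    · exact fun h j => h (A j) (PSet.Mem.mk A j)

end PName

/-! ### Absoluteness between V_κ and the universe. -/

namespace VModel

variable {P : Type u} {c : P → ZFSet.{u}} {κ : Cardinal.{u}}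

theorem mem_of_mem {x : ZFSet.{u}} {y : VModel c κ} (h : x ∈ y.1) :
    x ∈ ZFSet.vonNeumann κ.ord :=
  ZFSet.isTransitive_vonNeumann _ _ y.2 h

theorem rank_lt (x : VModel c κ) : x.1.rank < κ.ord := ZFSet.mem_vonNeumann.1 x.2

theorem isUPair_iff {x y z : VModel c κ} : IsUPair x y z ↔ z.1 = {x.1, y.1} := by
  constructor
  · intro h
    refine ZFSet.ext fun u => ?_
    rw [ZFSet.mem_pair]
    constructor
    · intro hu
      exact ((h ⟨u, mem_of_mem hu⟩).1 hu).imp (congrArg Subtype.val) (congrArg Subtype.val)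
    · rintro (rfl | rfl)
      · exact (h x).2 (Or.inl rfl)
      · exact (h y).2 (Or.inr rfl)
  · intro h u
    rw [Mem, h, ZFSet.mem_pair]
    exact or_congr Subtype.ext_iff.symm Subtype.ext_iff.symm

theorem isOrd_iff {x : VModel c κ} : IsOrd x ↔ x.1.IsOrdinal := by
  constructor
  · intro h
    refine ⟨fun y hy z hz => ?_, fun {z y w} hz hy hw => ?_⟩
    · have hy' := mem_of_mem hy
      exact h.1 ⟨y, hy'⟩ hy ⟨z, mem_of_mem (c := c) (y := ⟨y, hy'⟩) hz⟩ hz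
    · have hw' := mem_of_mem hw
      have hy' := mem_of_mem (c := c) (y := ⟨w, hw'⟩) hy
      have hz' := mem_of_mem (c := c) (y := ⟨y, hy'⟩) hz
      exact h.2 ⟨w, hw'⟩ hw ⟨y, hy'⟩ hy ⟨z, hz'⟩ hz
  · intro h
    exact ⟨fun y hy z hz => h.isTransitive _ hy hz, fun y hy z hz w hw => h.mem_trans' hw hz hy⟩

theorem IsPair.of_eq {x y z : VModel c κ} (h : z.1 = ZFSet.pair x.1 y.1) : IsPair x y z := by
  intro w
  rw [isUPair_iff, isUPair_iff, Mem, h, ZFSet.pair, ZFSet.mem_pair, ZFSet.pair_eq_singleton]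

/-- Internal quantifiers range over V_κ only; as κ is a limit, the members of the true pair are
there, so the internal notion misses nothing. -/
theorem isPair_iff (hκ : Order.IsSuccLimit κ.ord) {x y z : VModel c κ} :
    IsPair x y z ↔ z.1 = ZFSet.pair x.1 y.1 := by
  refine ⟨fun h => ZFSet.ext fun u => ?_, IsPair.of_eq⟩
  have key : ∀ w : VModel c κ, Mem w z ↔ w.1 ∈ ZFSet.pair x.1 y.1 := fun w => by
    rw [h w, isUPair_iff, isUPair_iff, ZFSet.pair, ZFSet.mem_pair, ZFSet.pair_eq_singleton]
  constructor
  · intro hu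
    exact (key ⟨u, mem_of_mem hu⟩).1 hu
  · intro hu
    have hu' : u ∈ ZFSet.vonNeumann κ.ord := by
      rw [ZFSet.mem_vonNeumann]
      rw [ZFSet.pair, ZFSet.mem_pair] at hu
      rcases hu with rfl | rfl
      · rw [ZFSet.rank_singleton]
        exact hκ.succ_lt x.rank_lt
      · rw [ZFSet.rank_pair]
        exact max_lt (hκ.succ_lt x.rank_lt) (hκ.succ_lt y.rank_lt)
    exact (key ⟨u, hu'⟩).2 hu

theorem rel_iff (hκ : Order.IsSuccLimit κ.ord) {x y r : VModel c κ} :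
    Rel x y r ↔ ZFSet.pair x.1 y.1 ∈ r.1 := by
  constructor
  · rintro ⟨z, hz, hr⟩
    rw [isPair_iff hκ] at hz
    exact hz ▸ hr
  · exact fun h => ⟨⟨_, mem_of_mem h⟩, IsPair.of_eq rfl, h⟩

theorem rel₃_iff (hκ : Order.IsSuccLimit κ.ord) {x y z r : VModel c κ} :
    Rel₃ x y z r ↔ ZFSet.pair x.1 (ZFSet.pair y.1 z.1) ∈ r.1 := by
  constructor
  · rintro ⟨w, hw, hr⟩
    rw [isPair_iff hκ] at hw
    rw [rel_iff hκ, hw] at hr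
    exact hr
  · intro h
    have hw : ZFSet.pair y.1 z.1 ∈ ZFSet.vonNeumann κ.ord :=
      ZFSet.mem_vonNeumann.2 ((rank_lt_rank_pair_right _ _).trans
        ((ZFSet.rank_lt_of_mem h).trans r.rank_lt))
    exact ⟨⟨_, hw⟩, IsPair.of_eq rfl, (rel_iff hκ).2 h⟩

/-- The code of a condition, as an element of `V_κ`. -/
def ofCond (hP : condSet c ∈ ZFSet.vonNeumann κ.ord) (p : P) : VModel c κ :=
  ⟨c p, ZFSet.isTransitive_vonNeumann _ _ hP (ZFSet.mem_range_self p)⟩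

variable {hP : condSet c ∈ ZFSet.vonNeumann κ.ord}

theorem cond_ofCond (p : P) : Cond (ofCond hP p) := ZFSet.mem_range_self p

theorem Cond.exists_eq {x : VModel c κ} (hx : Cond x) : ∃ p, ofCond hP p = x := by
  obtain ⟨p, hp⟩ := ZFSet.mem_range.1 hx
  exact ⟨p, Subtype.ext hp⟩

theorem rel_relSet_iff (hκ : Order.IsSuccLimit κ.ord) {r : P → P → Prop}
    {x y R : VModel c κ} (hR : R.1 = relSet c r) :
    Rel x y R ↔ ∃ p q, r p q ∧ x = ofCond hP p ∧ y = ofCond hP q := by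
  rw [rel_iff hκ, hR, mem_relSet]
  simp only [ZFSet.pair_inj]
  exact exists₂_congr fun p q => and_congr_right fun _ =>
    and_congr ⟨fun h => Subtype.ext h, congrArg _⟩ ⟨fun h => Subtype.ext h, congrArg _⟩

theorem pair_mem_toZFSet {ι : Type u} {nm : ι → PName P} {cond : ι → P} {x y : ZFSet.{u}} :
    ZFSet.pair x y ∈ (PName.mk ι nm cond).toZFSet c ↔
      ∃ i, x = (nm i).toZFSet c ∧ y = c (cond i) := by
  rw [PName.toZFSet, ZFSet.mem_range]
  simp only [ZFSet.pair_inj, eq_comm]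

variable [Preorder P]

theorem le_ofCond_iff (hc : Function.Injective c) {p q : P} :
    Le (ofCond hP p) (ofCond hP q) ↔ p ≤ q := by
  change _ ∈ relSet c (· ≤ ·) ↔ _
  rw [mem_relSet]
  constructor
  · rintro ⟨p', q', h, h'⟩
    obtain ⟨h1, h2⟩ := ZFSet.pair_inj.1 h'
    rwa [hc h1, hc h2]
  · exact fun h => ⟨p, q, h, rfl⟩

theorem Le.exists_eq {x y : VModel c κ} (h : Le x y) :
    ∃ p q, ofCond hP p = x ∧ ofCond hP q = y ∧ p ≤ q := by
  obtain ⟨p, q, h, h'⟩ := mem_relSet.1 (show _ ∈ relSet c (· ≤ ·) from h)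
  obtain ⟨h1, h2⟩ := ZFSet.pair_inj.1 h'
  exact ⟨p, q, Subtype.ext h1.symm, Subtype.ext h2.symm, h⟩

theorem exists_of_ofCond_le (hc : Function.Injective c) {p : P} {y : VModel c κ}
    (h : Le (ofCond hP p) y) : ∃ q, ofCond hP q = y ∧ p ≤ q := by
  obtain ⟨p', q, hp, rfl, hpq⟩ := h.exists_eq (hP := hP)
  exact ⟨q, rfl, (le_ofCond_iff hc).1 h⟩

/-- The recursive clause determines forcing by induction on the name: whatever a table asserts is
true. -/
theorem IsForcingTable.forcesEq (hc : Function.Injective c) (hκ : Order.IsSuccLimit κ.ord)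
    {B : VModel c κ} (hB : IsForcingTable B) (τ : PName P) :
    ∀ (X : PSet.{u}) (p : P) (a x : VModel c κ), a.1 = τ.toZFSet c → x.1 = ZFSet.mk X →
      Rel₃ a x (ofCond hP p) B → ForcesEq τ (PName.check P X) p := by
  induction τ with
  | mk ι nm cond ih =>
    intro X p a x ha hx h
    obtain ⟨h1, h2⟩ := hB a x _ h
    rw [forcesEq_check_iff]
    constructor
    · intro i q hpq hiq
      have hi : ZFSet.pair ((nm i).toZFSet c) (c (cond i)) ∈ a.1 := by
        rw [ha, pair_mem_toZFSet]
        exact ⟨i, rfl, rfl⟩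
      have hb : (nm i).toZFSet c ∈ ZFSet.vonNeumann κ.ord := ZFSet.mem_vonNeumann.2
        ((rank_lt_rank_pair_left _ _).trans ((ZFSet.rank_lt_of_mem hi).trans a.rank_lt))
      obtain ⟨r, hqr, y, hy, hr⟩ := h1 ⟨_, hb⟩ (ofCond hP (cond i)) ((rel_iff hκ).2 hi)
        (ofCond hP q) ((le_ofCond_iff hc).2 hpq) ((le_ofCond_iff hc).2 hiq)
      obtain ⟨r, rfl, hqr'⟩ := exists_of_ofCond_le hc hqr
      refine ⟨r, hqr', y.1.out, ?_, ih i _ r _ y rfl (ZFSet.mk_out _).symm hr⟩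
      rw [← ZFSet.mk_mem_iff, ZFSet.mk_out, ← hx]
      exact hy
    · intro Y hY q hpq
      have hY' : ZFSet.mk Y ∈ x.1 := by rwa [hx, ZFSet.mk_mem_iff]
      obtain ⟨r, hqr, b, s, hbs, hsr, hr⟩ := h2 ⟨_, mem_of_mem hY'⟩ hY' (ofCond hP q)
        ((le_ofCond_iff hc).2 hpq)
      obtain ⟨r, rfl, hqr'⟩ := exists_of_ofCond_le hc hqr
      rw [rel_iff hκ, ha, pair_mem_toZFSet] at hbs
      obtain ⟨i, hb, hs⟩ := hbs
      obtain rfl : s = ofCond hP (cond i) := Subtype.ext hs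
      exact ⟨r, hqr', i, (le_ofCond_iff hc).1 hsr, ih i Y r b _ hb rfl hr⟩

/-- Tables assert only true instances. Conversely, the set of all true instances of bounded rank is
a table, since the recursion only passes to names and sets of smaller rank. -/
theorem forcesCheck_iff (hc : Function.Injective c) (hκ : Order.IsSuccLimit κ.ord)
    {τ : PName P} {X : PSet.{u}} {p : P} {a x : VModel c κ} (ha : a.1 = τ.toZFSet c)
    (hx : x.1 = ZFSet.mk X) :
    ForcesCheck a x (ofCond hP p) ↔ ForcesEq τ (PName.check P X) p := by
  refine ⟨fun ⟨B, hB, h⟩ => hB.forcesEq hc hκ τ X p a x ha hx h, fun h => ?_⟩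
  let o : Ordinal.{u} := max (max a.1.rank x.1.rank) (condSet c).rank
  have ho : o < κ.ord := max_lt (max_lt a.rank_lt x.rank_lt) (ZFSet.mem_vonNeumann.1 hP)
  -- Each of the two nested pairs raises the rank bound by 2, so the triples have rank at most `o` +
  -- 4 and belong to V at `o` + 5.
  let o' : Ordinal.{u} := Order.succ (Order.succ (Order.succ (Order.succ (Order.succ o))))
  have ho' : o' < κ.ord :=
    hκ.succ_lt (hκ.succ_lt (hκ.succ_lt (hκ.succ_lt (hκ.succ_lt ho))))
  let S : ZFSet.{u} → Prop := fun z => ∃ (σ : PName P) (Y : PSet.{u}) (q : P),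
    z = ZFSet.pair (σ.toZFSet c) (ZFSet.pair (ZFSet.mk Y) (c q)) ∧ (σ.toZFSet c).rank ≤ o ∧
      (ZFSet.mk Y).rank ≤ o ∧ ForcesEq σ (PName.check P Y) q
  have hB : ZFSet.sep S (ZFSet.vonNeumann o') ∈ ZFSet.vonNeumann κ.ord :=
    ZFSet.mem_vonNeumann_of_subset ZFSet.sep_subset (ZFSet.vonNeumann_mem_of_lt ho')
  let B : VModel c κ := ⟨_, hB⟩
  have mem_B : ∀ (σ : PName P) (Y : PSet.{u}) (q : P) (b y : VModel c κ),
      b.1 = σ.toZFSet c → y.1 = ZFSet.mk Y → b.1.rank ≤ o → y.1.rank ≤ o →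
      ForcesEq σ (PName.check P Y) q → Rel₃ b y (ofCond hP q) B := by
    intro σ Y q b y hb hy hb' hy' h
    rw [rel₃_iff hκ]
    refine ZFSet.mem_sep.2 ⟨ZFSet.mem_vonNeumann.2 (Order.lt_succ_of_le ?_),
      σ, Y, q, ?_, hb ▸ hb', hy ▸ hy', h⟩
    · have hq : (ofCond hP q).1.rank ≤ o :=
        (ZFSet.rank_lt_of_mem (cond_ofCond (hP := hP) q)).le.trans (le_max_right _ _)
      exact rank_pair_le (hb'.trans ((Order.le_succ _).trans (Order.le_succ _)))
        (rank_pair_le hy' hq)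
    · rw [hb, hy]
      rfl
  refine ⟨B, ?_, mem_B τ X p a x ha hx ((le_max_left _ _).trans (le_max_left _ _))
    ((le_max_right _ _).trans (le_max_left _ _)) h⟩
  intro b y q hbyq
  rw [rel₃_iff hκ] at hbyq
  obtain ⟨-, σ, Y, q', hz, hσo, hYo, hσ⟩ := ZFSet.mem_sep.1 hbyq
  obtain ⟨hb, hz⟩ := ZFSet.pair_inj.1 hz
  obtain ⟨hy, hq⟩ := ZFSet.pair_inj.1 hz
  obtain rfl : q = ofCond hP q' := Subtype.ext hq
  obtain ⟨ι, nm, cond⟩ := σ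
  rw [forcesEq_check_iff] at hσ
  have hnm : ∀ i, ((nm i).toZFSet c).rank < ((PName.mk ι nm cond).toZFSet c).rank := fun i =>
    (rank_lt_rank_pair_left _ _).trans
      (ZFSet.rank_lt_of_mem (pair_mem_toZFSet.2 ⟨i, rfl, rfl⟩))
  constructor
  · intro d s hds r hqr hsr
    rw [rel_iff hκ, hb, pair_mem_toZFSet] at hds
    obtain ⟨i, hd, hs⟩ := hds
    obtain rfl : s = ofCond hP (cond i) := Subtype.ext hs
    obtain ⟨r, rfl, hqr'⟩ := exists_of_ofCond_le hc hqr
    obtain ⟨t, hrt, Z, hZ, hF⟩ := hσ.1 i r hqr' ((le_ofCond_iff hc).1 hsr)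
    have hZ' : ZFSet.mk Z ∈ y.1 := by rwa [hy, ZFSet.mk_mem_iff]
    refine ⟨ofCond hP t, (le_ofCond_iff hc).2 hrt, ⟨_, mem_of_mem hZ'⟩, hZ',
      mem_B _ Z t d _ hd rfl ?_ ?_ hF⟩
    · rw [hd]
      exact (hnm i).le.trans hσo
    · exact (ZFSet.rank_lt_of_mem hZ').le.trans (hy ▸ hYo)
  · intro z hzy r hqr
    obtain ⟨r, rfl, hqr'⟩ := exists_of_ofCond_le hc hqr
    have hz' : z.1.out ∈ Y := by
      rw [← ZFSet.mk_mem_iff, ZFSet.mk_out, ← hy]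
      exact hzy
    obtain ⟨t, hrt, i, hit, hF⟩ := hσ.2 _ hz' r hqr'
    have hi : ZFSet.pair ((nm i).toZFSet c) (c (cond i)) ∈ b.1 := by
      rw [hb, pair_mem_toZFSet]
      exact ⟨i, rfl, rfl⟩
    have hi' : (nm i).toZFSet c ∈ ZFSet.vonNeumann κ.ord := ZFSet.mem_vonNeumann.2
      ((rank_lt_rank_pair_left _ _).trans ((ZFSet.rank_lt_of_mem hi).trans b.rank_lt))
    refine ⟨ofCond hP t, (le_ofCond_iff hc).2 hrt, ⟨_, hi'⟩, ofCond hP (cond i),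
      (rel_iff hκ).2 hi, (le_ofCond_iff hc).2 hit,
      mem_B _ _ t _ z rfl (ZFSet.mk_out _).symm ((hnm i).le.trans hσo) ?_ hF⟩
    exact (ZFSet.rank_lt_of_mem hzy).le.trans (hy ▸ hYo)

end VModel

/-- A name which is forced to be equal to a ground model set has at least the rank of that set. -/
theorem rank_le_of_forcesEq_check {P : Type u} [Preorder P] (c : P → ZFSet.{u}) (τ : PName P) :
    ∀ (X : PSet.{u}) (p : P), ForcesEq τ (PName.check P X) p → X.rank ≤ (τ.toZFSet c).rank := by
  induction τ with
  | mk ι nm cond ih =>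
    intro X p h
    rw [PSet.rank_le_iff]
    intro Y hY
    obtain ⟨r, -, i, -, hr⟩ := (forcesEq_check_iff.1 h).2 Y hY p le_rfl
    exact (ih i Y r hr).trans_lt ((rank_lt_rank_pair_left _ _).trans
      (ZFSet.rank_lt_of_mem (VModel.pair_mem_toZFSet.2 ⟨i, rfl, rfl⟩)))

theorem finite_vonNeumann_natCast (n : ℕ) : {x : ZFSet.{u} | x ∈ ZFSet.vonNeumann n}.Finite := by
  induction n with
  | zero => simp
  | succ n ih =>
    rw [Nat.cast_add, Nat.cast_one, ZFSet.vonNeumann_add_one]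
    refine (ih.finite_subsets.preimage (f := fun x : ZFSet => {y | y ∈ x}) ?_).subset ?_
    · exact fun x _ y _ h => ZFSet.ext fun z => Set.ext_iff.1 h z
    · exact fun x hx y hy => ZFSet.mem_powerset.1 hx hy

theorem IsLargeFor.condSet_mem {P : Type u} {c : P → ZFSet.{u}} {κ : Cardinal.{u}}
    (h : IsLargeFor c κ) : condSet c ∈ ZFSet.vonNeumann κ.ord :=
  ZFSet.isTransitive_vonNeumann _ _ h (ZFSet.mem_powerset.2 subset_rfl)

/-- Infinitely many codes do not fit into a finite V_n, so κ is infinite. -/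
theorem IsLargeFor.isSuccLimit_ord {P : Type u} [Infinite P] {c : P → ZFSet.{u}}
    (hc : Function.Injective c) {κ : Cardinal.{u}} (h : IsLargeFor c κ) :
    Order.IsSuccLimit κ.ord := by
  refine Cardinal.isSuccLimit_ord (le_of_not_gt fun hκ => ?_)
  obtain ⟨n, rfl⟩ := Cardinal.lt_aleph0.1 hκ
  have hn := h.condSet_mem
  rw [Cardinal.ord_natCast] at hn
  refine Set.infinite_range_of_injective hc ((finite_vonNeumann_natCast n).subset ?_)
  rintro _ ⟨p, rfl⟩
  exact ZFSet.isTransitive_vonNeumann _ _ hn (ZFSet.mem_range_self p)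

/-! ### Finite fronts and generic conditions over an elementary substructure. -/

namespace VModel

variable {P : Type u} {c : P → ZFSet.{u}} {κ : Cardinal.{u}}
  {hP : condSet c ∈ ZFSet.vonNeumann κ.ord}

/-- A member of least cardinality is minimal. -/
theorem FinSection.of_finite {Fr s : VModel c κ} (h : {d | Rel s d Fr}.Finite) :
    FinSection Fr s := by
  rintro A hA hAs
  let f : VModel c κ → ℕ := fun a => {d | Mem d a}.ncard
  obtain ⟨a, ha, hmin⟩ := (measure f).wf.has_min {a | Mem a A} hA
  refine ⟨a, ha, fun b hb hba d hd => ?_⟩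
  have hfin : {d | Mem d a}.Finite := h.subset fun d => hAs a ha d
  have := Set.eq_of_subset_of_ncard_le (s := {d | Mem d b}) (t := {d | Mem d a}) hba
    (not_lt.1 (hmin b hb)) hfin
  exact this.symm.subset hd

/-- Apply the hypothesis to the family of cofinite subsets of the section. Removing a point keeps a
set cofinite, so a minimal member is empty, and the section itself is finite. -/
theorem FinSection.finite (hκ : Order.IsSuccLimit κ.ord) {Fr s : VModel c κ}
    (h : FinSection Fr s) : {d | Rel s d Fr}.Finite := by
  let S : ZFSet.{u} := ZFSet.sep (fun d => ZFSet.pair s.1 d ∈ Fr.1) (ZFSet.vonNeumann Fr.1.rank)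
  have hS : ∀ d, d ∈ S ↔ ZFSet.pair s.1 d ∈ Fr.1 := fun d => by
    rw [ZFSet.mem_sep, and_iff_right_iff_imp, ZFSet.mem_vonNeumann]
    exact fun h => (rank_lt_rank_pair_right _ _).trans (ZFSet.rank_lt_of_mem h)
  have hSκ : Order.succ S.rank < κ.ord := by
    refine hκ.succ_lt (lt_of_le_of_lt ?_ Fr.rank_lt)
    exact (ZFSet.rank_mono ZFSet.sep_subset).trans (ZFSet.rank_vonNeumann _).le
  let A : ZFSet.{u} := ZFSet.sep (fun a => {d | d ∈ S ∧ d ∉ a}.Finite) (ZFSet.powerset S)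
  have hA : A ∈ ZFSet.vonNeumann κ.ord := by
    rw [ZFSet.mem_vonNeumann]
    exact ((ZFSet.rank_mono ZFSet.sep_subset).trans (ZFSet.rank_powerset _).le).trans_lt hSκ
  have hA' : ∀ a, a ∈ A ↔ a ⊆ S ∧ {d | d ∈ S ∧ d ∉ a}.Finite := fun a => by
    rw [ZFSet.mem_sep, ZFSet.mem_powerset]
  have hSA : S ∈ A := (hA' S).2 ⟨subset_rfl, by simp⟩
  obtain ⟨a, ha, hmin⟩ := h ⟨A, hA⟩ ⟨⟨S, ZFSet.isTransitive_vonNeumann _ _ hA hSA⟩, hSA⟩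
    (fun a ha d hd => (rel_iff hκ).2 ((hS _).1 (((hA' _).1 ha).1 hd)))
  obtain ⟨haS, hafin⟩ := (hA' _).1 ha
  have hempty : ∀ d, d ∉ a.1 := by
    intro d hd
    have hb : ZFSet.sep (· ≠ d) a.1 ∈ A := by
      refine (hA' _).2 ⟨fun z hz => haS (ZFSet.mem_sep.1 hz).1, (hafin.insert d).subset ?_⟩
      rintro z ⟨hzS, hz⟩
      by_cases hzd : z = d
      · exact Or.inl hzd
      · exact Or.inr ⟨hzS, fun hza => hz (ZFSet.mem_sep.2 ⟨hza, hzd⟩)⟩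
    have hbV := ZFSet.isTransitive_vonNeumann _ _ hA hb
    have := hmin ⟨_, hbV⟩ hb (fun z hz => (ZFSet.mem_sep.1 (show z.1 ∈ ZFSet.sep (· ≠ d) a.1 from hz)).1)
      ⟨d, mem_of_mem hd⟩ hd
    exact (ZFSet.mem_sep.1 (show d ∈ ZFSet.sep (· ≠ d) a.1 from this)).2 rfl
  refine Set.Finite.of_finite_image (f := Subtype.val) (hafin.subset ?_)
    Subtype.val_injective.injOn
  rintro _ ⟨d, hd, rfl⟩
  exact ⟨(hS _).2 ((rel_iff hκ).1 hd), hempty _⟩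

variable [Preorder P]

theorem IsDenseOpen.setOf (hc : Function.Injective c) {D : VModel c κ} (hD : IsDenseOpen D) :
    LTForcing.IsDenseOpen {p : P | Mem (ofCond hP p) D} := by
  refine ⟨fun p => ?_, fun p hp q hpq => hD.2 _ hp _ ((le_ofCond_iff hc).2 hpq)⟩
  obtain ⟨q, hq, hpq⟩ := hD.1 _ (cond_ofCond (hP := hP) p)
  obtain ⟨q, rfl, hpq'⟩ := exists_of_ofCond_le hc hpq
  exact ⟨q, hq, hpq'⟩

/-- States are conditions here, so that the relation and the fronts are sets of pairs of conditions,
of rank only 2 above that of the forcing notion. -/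
theorem exists_isFrontSystem (hP : condSet c ∈ ZFSet.vonNeumann κ.ord)
    (hc : Function.Injective c) (hκ : Order.IsSuccLimit κ.ord) (F : FrontSystem P P) :
    ∃ R Fr : VModel c κ, IsFrontSystem R Fr := by
  have hex : ∀ r : P → P → Prop, relSet c r ∈ ZFSet.vonNeumann κ.ord := fun r =>
    ZFSet.mem_vonNeumann.2 ((rank_relSet_le le_rfl).trans_lt
      (hκ.succ_lt (hκ.succ_lt (ZFSet.mem_vonNeumann.1 hP))))
  let R : VModel c κ := ⟨_, hex F.rel⟩
  let Fr : VModel c κ := ⟨_, hex fun s d => d ∈ F.front s⟩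
  have hR : ∀ x y, Rel x y R ↔ ∃ p q, F.rel p q ∧ x = ofCond hP p ∧ y = ofCond hP q :=
    fun x y => rel_relSet_iff hκ rfl
  have hFr : ∀ x y, Rel x y Fr ↔ ∃ p q, q ∈ F.front p ∧ x = ofCond hP p ∧ y = ofCond hP q :=
    fun x y => rel_relSet_iff hκ rfl
  have inj : Function.Injective (ofCond hP) := fun p q h => hc (congrArg Subtype.val h)
  have hR' : ∀ p q, Rel (ofCond hP p) (ofCond hP q) R ↔ F.rel p q := fun p q => by
    rw [hR]
    exact ⟨fun ⟨p', q', h, hp, hq⟩ => inj hp ▸ inj hq ▸ h, fun h => ⟨p, q, h, rfl, rfl⟩⟩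
  have hFr' : ∀ p q, Rel (ofCond hP p) (ofCond hP q) Fr ↔ q ∈ F.front p := fun p q => by
    rw [hFr]
    exact ⟨fun ⟨p', q', h, hp, hq⟩ => inj hp ▸ inj hq ▸ h, fun h => ⟨p, q, h, rfl, rfl⟩⟩
  refine ⟨R, Fr, fun s => FinSection.of_finite ?_, ?_, ?_, ?_, ?_, ?_⟩
  · by_cases hs : ∃ p, s = ofCond hP p
    · obtain ⟨p, rfl⟩ := hs
      refine ((F.finite_front p).image (ofCond hP)).subset fun d hd => ?_
      obtain ⟨p', q, hq, hp, rfl⟩ := (hFr _ _).1 hd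
      exact ⟨q, inj hp ▸ hq, rfl⟩
    · refine Set.finite_empty.subset fun d hd => hs ?_
      obtain ⟨p', q, hq, hp, rfl⟩ := (hFr _ _).1 hd
      exact ⟨p', hp⟩
  · intro s s' h
    obtain ⟨p, q, hpq, rfl, rfl⟩ := (hR _ _).1 h
    exact (hR' _ _).2 (F.rel_refl _ _ hpq)
  · intro s s' s'' h h'
    obtain ⟨p, q, hpq, rfl, rfl⟩ := (hR _ _).1 h
    obtain ⟨q', r, -, hq, rfl⟩ := (hR _ _).1 h'
    exact (hR' _ _).2 (F.rel_trans _ _ _ hpq ((hR' _ _).1 h'))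
  · intro p hp
    obtain ⟨p, rfl⟩ := hp.exists_eq (hP := hP)
    obtain ⟨s, hs, hd⟩ := F.exists_start p
    refine ⟨ofCond hP s, (hR' _ _).2 hs, fun d hsd => ?_⟩
    obtain ⟨s', d, h, hs', rfl⟩ := (hFr _ _).1 hsd
    exact (le_ofCond_iff hc).2 (hd d (inj hs' ▸ h))
  · intro s hs D hD
    obtain ⟨s, -, -, rfl, -⟩ := (hR _ _).1 hs
    obtain ⟨s', hs', hD'⟩ := F.exists_step s ((hR' _ _).1 hs) _ (hD.setOf (hP := hP) hc)
    refine ⟨ofCond hP s', (hR' _ _).2 hs', fun d hsd => ?_⟩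
    obtain ⟨s'', d, h, hs', rfl⟩ := (hFr _ _).1 hsd
    exact hD' (inj hs' ▸ h)
  · rintro C ⟨s, hs⟩ hC
    -- The chain condition applied to `s` twice shows that `s` is in the field of the relation.
    have hC' : ∀ s, Mem s C → ∃ p, s = ofCond hP p := fun s hs => by
      obtain ⟨p, -, -, hp, -⟩ := (hR _ _).1 ((hC s hs s hs).elim id id)
      exact ⟨p, hp⟩
    obtain ⟨q, hq⟩ := F.exists_limit {p | Mem (ofCond hP p) C}
      (by obtain ⟨p, rfl⟩ := hC' s hs; exact ⟨p, hs⟩)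
      (fun p hp p' hp' => (hC _ hp _ hp').imp (hR' _ _).1 (hR' _ _).1)
    refine ⟨ofCond hP q, cond_ofCond q, fun s hs r hr => ?_⟩
    obtain ⟨p, rfl⟩ := hC' s hs
    obtain ⟨r, rfl, hr'⟩ := exists_of_ofCond_le hc hr
    obtain ⟨d, hd, t, hrt, hdt⟩ := hq p hs r hr'
    exact ⟨ofCond hP d, (hFr' _ _).2 hd, ofCond hP t, (le_ofCond_iff hc).2 hrt,
      (le_ofCond_iff hc).2 hdt⟩

section Elementary

variable {N : forcingLanguage.ElementarySubstructure (VModel c κ)}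

/-- The fusion is run over an enumeration of the dense open sets in `N`, each state being chosen in
`N` by elementarity. The resulting condition itself need not be in `N`. -/
theorem exists_generic [Countable N] (hc : Function.Injective c) (hκ : Order.IsSuccLimit κ.ord)
    (F : FrontSystem P P) {p : P} (hp : ofCond hP p ∈ N) :
    ∃ q, p ≤ q ∧ ∀ D ∈ N, IsDenseOpen D → ∀ r, q ≤ r →
      ∃ d t, ofCond hP d ∈ N ∧ Mem (ofCond hP d) D ∧ r ≤ t ∧ d ≤ t := by
  obtain ⟨R, hRN, Fr', hRFr'⟩ := Dfn.exists_mem (N := N)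
    (R := fun R => ∃ Fr, IsFrontSystem R Fr)
    (Dfn.ex (dfn_isFrontSystem (Tm.var _) (Tm.var _))) (exists_isFrontSystem hP hc hκ F)
  obtain ⟨Fr, hFrN, hfin, hrefl, htrans, hstart, hstep, hlimit⟩ := Dfn.exists_mem (N := N)
    (R := fun Fr => IsFrontSystem R Fr) (dfn_isFrontSystem (Tm.const hRN) (Tm.var _))
    ⟨Fr', hRFr'⟩
  obtain ⟨D₀, hD₀N, hD₀⟩ := Dfn.exists_mem (N := N) (R := IsDenseOpen)
    (dfn_isDenseOpen (Tm.var _)) ⟨⟨condSet c, hP⟩, fun p hp => by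
      obtain ⟨p, rfl⟩ := hp.exists_eq (hP := hP)
      exact ⟨_, hp, (le_ofCond_iff hc).2 le_rfl⟩, fun p _ q hpq => by
      obtain ⟨-, q, -, rfl, -⟩ := hpq.exists_eq (hP := hP)
      exact cond_ofCond q⟩
  have : Nonempty {D : N // IsDenseOpen D.1} := ⟨⟨⟨D₀, hD₀N⟩, hD₀⟩⟩
  obtain ⟨D, hDsurj⟩ := exists_surjective_nat {D : N // IsDenseOpen D.1}
  obtain ⟨s₀, hs₀N, hs₀, hps₀⟩ := Dfn.exists_mem (N := N)
    (R := fun s => Rel s s R ∧ ∀ d, Rel s d Fr → Le (ofCond hP p) d)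
    (Dfn.and (dfn_rel (Tm.var _) (Tm.var _) (Tm.const hRN))
      (Dfn.all (Dfn.imp (dfn_rel (Tm.var _) (Tm.var _) (Tm.const hFrN))
        (dfn_le (Tm.const hp) (Tm.var _))))) (hstart _ (cond_ofCond p))
  have step : ∀ n (s : {s // s ∈ N ∧ Rel s s R}), ∃ s' : {s // s ∈ N ∧ Rel s s R},
      Rel s.1 s'.1 R ∧ ∀ d, Rel s'.1 d Fr → Mem d (D n).1.1 := fun n s => by
    obtain ⟨s', hs'N, hss', hs'⟩ := Dfn.exists_mem (N := N)
      (R := fun s' => Rel s.1 s' R ∧ ∀ d, Rel s' d Fr → Mem d (D n).1.1)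
      (Dfn.and (dfn_rel (Tm.const s.2.1) (Tm.var _) (Tm.const hRN))
        (Dfn.all (Dfn.imp (dfn_rel (Tm.var _) (Tm.var _) (Tm.const hFrN))
          (dfn_mem (Tm.var _) (Tm.const (D n).1.2))))) (hstep s.1 s.2.2 _ (D n).2)
    exact ⟨⟨s', hs'N, hrefl _ _ hss'⟩, hss', hs'⟩
  choose g hg hgD using step
  let x : ℕ → {s // s ∈ N ∧ Rel s s R} := fun n => Nat.rec ⟨s₀, hs₀N, hs₀⟩ g n
  have hx : ∀ m n, m ≤ n → Rel (x m).1 (x n).1 R := by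
    intro m n h
    induction h with
    | refl => exact (x m).2.2
    | step _ ih => exact htrans _ _ _ ih (hg _ _)
  -- The chain is usually not in `N`, but it is an element of V_κ, where the limit axiom holds: its
  -- members have smaller rank than `R`.
  have hC : ZFSet.range (fun n => (x n).1.1) ∈ ZFSet.vonNeumann κ.ord := by
    refine ZFSet.mem_vonNeumann.2 (lt_of_le_of_lt (ZFSet.rank_le_iff.2 fun y hy => ?_) R.rank_lt)
    obtain ⟨n, rfl⟩ := ZFSet.mem_range.1 hy
    exact (rank_lt_rank_pair_left _ _).trans (ZFSet.rank_lt_of_mem ((rel_iff hκ).1 (x n).2.2))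
  have hmemC : ∀ s, Mem s ⟨_, hC⟩ ↔ ∃ n, (x n).1 = s := fun s =>
    ZFSet.mem_range.trans (exists_congr fun n => ⟨fun h => Subtype.ext h, congrArg _⟩)
  obtain ⟨q, hq, hqC⟩ := hlimit ⟨_, hC⟩ ⟨_, (hmemC _).2 ⟨0, rfl⟩⟩ (by
    intro s hs s' hs'
    obtain ⟨m, rfl⟩ := (hmemC _).1 hs
    obtain ⟨n, rfl⟩ := (hmemC _).1 hs'
    exact (le_total m n).imp (hx _ _) (hx _ _))
  obtain ⟨q, rfl⟩ := hq.exists_eq (hP := hP)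
  obtain ⟨d, hd, t, hqt, hdt⟩ := hqC (x 0).1 ((hmemC _).2 ⟨0, rfl⟩) _ ((le_ofCond_iff hc).2 le_rfl)
  obtain ⟨d, rfl, hpd⟩ := exists_of_ofCond_le hc (hps₀ d hd)
  obtain ⟨t, rfl, hqt'⟩ := exists_of_ofCond_le hc hqt
  refine ⟨t, hpd.trans ((le_ofCond_iff hc).1 hdt), fun E hEN hE r htr => ?_⟩
  obtain ⟨n, hn⟩ := hDsurj ⟨⟨E, hEN⟩, hE⟩
  obtain ⟨e, he, t', hrt', het'⟩ := hqC (x (n + 1)).1 ((hmemC _).2 ⟨n + 1, rfl⟩) _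
    ((le_ofCond_iff hc).2 (hqt'.trans htr))
  obtain ⟨e, t', rfl, rfl, het⟩ := het'.exists_eq (hP := hP)
  refine ⟨e, t', ?_, ?_, (le_ofCond_iff hc).1 hrt', het⟩
  -- Here finiteness of the front is essential: it is what puts its members into `N`.
  · exact Dfn.mem_of_finite (R := fun d => Rel (x (n + 1)).1 d Fr)
      (dfn_rel (Tm.const (x (n + 1)).2.1) (Tm.var _) (Tm.const hFrN))
      (FinSection.finite hκ (hfin _)) he
  · have := hgD n (x n) _ he
    rwa [hn] at this

/-- The set of all conditions deciding `τ` is definable from the code of `τ`, so it lies in `N`; a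
decided value is definable from `τ` and the condition. -/
theorem exists_deciding_set (hc : Function.Injective c) (hκ : Order.IsSuccLimit κ.ord)
    {τ : PName P} (hτ : τ.IsOrdinalName) {a : VModel c κ} (haN : a ∈ N)
    (ha : a.1 = τ.toZFSet c) :
    ∃ D ∈ N, IsDenseOpen D ∧ ∀ d : P, ofCond hP d ∈ N → Mem (ofCond hP d) D →
      ∃ β : Ordinal.{u}, β.toZFSet ∈ Subtype.val '' (N : Set (VModel c κ)) ∧
        ForcesEq τ (PName.ord P β) d := by
  have hx : ∀ x : VModel c κ, IsOrd x → ∃ β : Ordinal.{u}, x.1 = β.toZFSet := fun x h =>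
    ⟨_, (isOrd_iff.1 h).toZFSet_rank_eq.symm⟩
  have hF : ∀ (β : Ordinal.{u}) (x : VModel c κ) (p : P), x.1 = β.toZFSet →
      (ForcesCheck a x (ofCond hP p) ↔ ForcesEq τ (PName.ord P β) p) := fun β x p hxβ =>
    forcesCheck_iff hc hκ ha (hxβ.trans (Ordinal.mk_toPSet β).symm)
  let S : ZFSet.{u} := ZFSet.sep
    (fun d => ∃ d' : VModel c κ, d'.1 = d ∧ ∃ x, IsOrd x ∧ ForcesCheck a x d') (condSet c)
  have hS : ∀ z, z ∈ S ↔ z ∈ condSet c ∧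
      ∃ d' : VModel c κ, d'.1 = z ∧ ∃ x, IsOrd x ∧ ForcesCheck a x d' := fun z => ZFSet.mem_sep
  obtain ⟨D, hDN, hD⟩ := Dfn.exists_mem (N := N)
    (R := fun D => ∀ d, Mem d D ↔ Cond d ∧ ∃ x, IsOrd x ∧ ForcesCheck a x d)
    (Dfn.all (Dfn.iff (dfn_mem (Tm.var _) (Tm.var _)) (Dfn.and (dfn_cond (Tm.var _))
      (Dfn.ex (Dfn.and (dfn_isOrd (Tm.var _))
        (dfn_forcesCheck (Tm.const haN) (Tm.var _) (Tm.var _)))))))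
    ⟨⟨S, ZFSet.mem_vonNeumann_of_subset ZFSet.sep_subset hP⟩, fun d => by
        refine (hS d.1).trans ?_
        refine and_congr_right fun _ => ⟨?_, fun h => ⟨d, rfl, h⟩⟩
        rintro ⟨d', hd', h⟩
        exact (Subtype.ext hd' : d' = d) ▸ h⟩
  refine ⟨D, hDN, ⟨fun p hp => ?_, fun p hp q hpq => ?_⟩, fun d hdN hd => ?_⟩
  · obtain ⟨p, rfl⟩ := hp.exists_eq (hP := hP)
    obtain ⟨q, hpq, β, hβ⟩ := hτ p
    -- The value has rank at most that of its name, so the internal quantifier over ordinals reaches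
    -- it.
    have hβκ : β < κ.ord := by
      have := rank_le_of_forcesEq_check c τ _ q hβ
      rw [Ordinal.rank_toPSet] at this
      exact this.trans_lt (ha ▸ a.rank_lt)
    have hβV : β.toZFSet ∈ ZFSet.vonNeumann κ.ord := by
      rwa [ZFSet.mem_vonNeumann, Ordinal.rank_toZFSet]
    exact ⟨ofCond hP q, (hD _).2 ⟨cond_ofCond q, ⟨_, hβV⟩,
      isOrd_iff.2 (ZFSet.isOrdinal_toZFSet β), (hF β _ q rfl).2 hβ⟩, (le_ofCond_iff hc).2 hpq⟩
  · obtain ⟨p, q, rfl, rfl, hpq'⟩ := hpq.exists_eq (hP := hP)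
    obtain ⟨-, x, hxo, hxp⟩ := (hD _).1 hp
    obtain ⟨β, hβ⟩ := hx x hxo
    exact (hD _).2 ⟨cond_ofCond q, x, hxo, (hF β x q hβ).2 (((hF β x p hβ).1 hxp).mono hpq')⟩
  · obtain ⟨x, hxN, hxo, hxd⟩ := Dfn.exists_mem (N := N)
      (R := fun x => IsOrd x ∧ ForcesCheck a x (ofCond hP d))
      (Dfn.and (dfn_isOrd (Tm.var _)) (dfn_forcesCheck (Tm.const haN) (Tm.var _) (Tm.const hdN)))
      ((hD _).1 hd).2
    obtain ⟨β, hβ⟩ := hx x hxo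
    exact ⟨β, ⟨x, hxN, hβ⟩, (hF β x d hβ).1 hxd⟩

end Elementary

end VModel

theorem FrontSystem.isProperForcing {P : Type u} [Preorder P] [Infinite P] (F : FrontSystem P P) :
    IsProperForcing P := by
  rintro c hc κ hlarge N hN M rfl - p ⟨x, hxN, hx⟩
  have hκ := hlarge.isSuccLimit_ord hc
  have hP := hlarge.condSet_mem
  obtain rfl : x = VModel.ofCond hP p := Subtype.ext hx
  obtain ⟨q, hpq, hq⟩ := VModel.exists_generic hc hκ F hxN
  refine ⟨q, hpq, ?_⟩
  rintro τ hτ ⟨a, haN, ha⟩ r hqr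
  obtain ⟨D, hDN, hD, hdec⟩ := VModel.exists_deciding_set (hP := hP) hc hκ hτ haN ha
  obtain ⟨d, t, hdN, hdD, hrt, hdt⟩ := hq D hDN hD r hqr
  obtain ⟨β, hβ, hdβ⟩ := hdec d hdN hdD
  exact ⟨t, hrt, β, hβ, hdβ.mono hdt⟩

/-! ### Subtrees with diverging norms as conditions. -/

/-- A tree with a splitting node has a stem. -/
theorem exists_isStem {T : Set (List ℕ)} (hT : ∀ η ν : List ℕ, ν ∈ T → η <+: ν → η ∈ T)
    (h : ∃ s ∈ T, (succs T s).Nontrivial) : ∃ s, IsStem T s := by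
  obtain ⟨s, ⟨hs, hsplit⟩, hmin⟩ := (measure List.length).wf.has_min
    {s | s ∈ T ∧ (succs T s).Nontrivial} h
  refine ⟨s, hs, fun η => ?_, hsplit⟩
  induction η using List.reverseRecOn with
  | nil => exact fun _ => Or.inl List.nil_prefix
  | append_singleton η n ih =>
    intro hη
    rcases ih (hT _ _ hη (List.prefix_append _ _)) with h | h
    · obtain ⟨l, rfl⟩ := h
      cases l with
      | nil => exact Or.inr (by simp)
      | cons m l =>
        by_cases hmn : m = n
        · subst hmn
          exact Or.inl ⟨l, by simp⟩
        · have hm : η ++ [m] ∈ T := hT _ _ hs ⟨l, by simp⟩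
          exact absurd (show List.length η < List.length (η ++ m :: l) by simp)
            (hmin η ⟨hT _ _ hη (List.prefix_append _ _), m, hm, n, hη, hmn⟩)
    · exact Or.inr (h.trans (List.prefix_append _ _))

theorem mem_ess_of_length_le {T : Set (List ℕ)} {s η : List ℕ} (hs : IsStem T s) (hη : η ∈ T)
    (h : s.length ≤ η.length) : η ∈ ess T := by
  refine ⟨hη, s, hs, ?_⟩
  rcases hs.2.1 η hη with h' | h'
  · rw [h'.eq_of_length_le h]
  · exact h'

/-- A branch through a predicate on nodes. -/
theorem exists_branch {A : List ℕ → Prop} (h0 : A [])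
    (hA : ∀ η, A η → ∃ n, A (η ++ [n])) : ∃ x : ℕ → ℕ, ∀ k, A ((List.range k).map x) := by
  choose! f hf using hA
  let L : ℕ → List ℕ := fun k => Nat.rec [] (fun _ η => η ++ [f η]) k
  have hL : ∀ k, L k = (List.range k).map fun i => f (L i) := by
    intro k
    induction k with
    | zero => rfl
    | succ k ih =>
      rw [List.range_succ, List.map_append, ← ih]
      rfl
  refine ⟨fun i => f (L i), fun k => ?_⟩
  rw [← hL]
  induction k with
  | zero => exact h0
  | succ k ih => exact hf _ ih

namespace LT

theorem nil_mem (p : LT) : [] ∈ p.tree := by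
  obtain ⟨s, hs, -⟩ := p.exists_stem
  exact p.prefix_closed _ _ hs List.nil_prefix

theorem mem_ess_of_meas_pos {p : LT} {η : List ℕ} {S : Set ℕ} (h : 0 < p.meas η S) :
    η ∈ ess p.tree ∧ S.Nonempty ∧ S ⊆ succs p.tree η := by
  by_contra hc
  exact h.ne' (p.meas_eq_zero η S hc)

theorem meas_le_of_le {p q : LT} (h : p ≤ q) (η : List ℕ) (S : Set ℕ) :
    q.meas η S ≤ p.meas η S := by
  by_cases hc : η ∈ ess q.tree ∧ S.Nonempty ∧ S ⊆ succs q.tree η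
  · exact (h.2 η hc.1 S hc.2.1 hc.2.2).le
  · simp [q.meas_eq_zero η S hc]

/-- Both measures are restrictions of that of `p`, so among extensions of `p` only the trees need to
be compared. -/
theorem le_of_tree_subset {p q r : LT} (hpq : p ≤ q) (hpr : p ≤ r) (h : r.tree ⊆ q.tree) :
    q ≤ r := by
  refine ⟨h, fun η hη S hS hSr => ?_⟩
  rw [hpr.2 η hη S hS hSr,
    hpq.2 η (ess_subset_ess h q.exists_stem hη) S hS (hSr.trans fun n hn => h hn)]

theorem meas_mono {p : LT} {η : List ℕ} {S S' : Set ℕ} (hS : S ⊆ S')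
    (hS' : S' ⊆ succs p.tree η) : p.meas η S ≤ p.meas η S' := by
  by_cases h : 0 < p.meas η S
  · obtain ⟨hη, hne, -⟩ := mem_ess_of_meas_pos h
    exact (p.isLogMeasure η hη).mono S S' hne hS hS'
  · simp [Nat.eq_zero_of_not_pos h]

/-- If finite ramification holds, then the norms of a divergent condition tend to infinity uniformly
on the levels of the tree. -/
theorem exists_level {p : LT} (hfin : p.FinitelyBranching) (hdiv : p.Divergent) (m : ℕ) :
    ∃ k, ∀ ν ∈ p.tree, k ≤ ν.length → m ≤ p.norm ν := by
  by_contra! hcon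
  -- König's lemma: a node with arbitrarily high extensions of norm below `m` has such a successor,
  -- because there are only finitely many successors.
  let A : List ℕ → Prop := fun η =>
    η ∈ p.tree ∧ ∀ k, ∃ ν ∈ p.tree, k ≤ ν.length ∧ η <+: ν ∧ p.norm ν < m
  have hA : ∀ η, A η → ∃ n, A (η ++ [n]) := by
    rintro η ⟨hη, h⟩
    by_contra! hn
    have : ∀ n, ∃ k, η ++ [n] ∈ p.tree → ∀ ν ∈ p.tree, k ≤ ν.length → η ++ [n] <+: ν →
        m ≤ p.norm ν := fun n => by
      by_cases hmem : η ++ [n] ∈ p.tree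
      · have := hn n
        simp only [A, not_and, hmem, true_imp_iff] at this
        push Not at this
        obtain ⟨k, hk⟩ := this
        exact ⟨k, fun _ => hk⟩
      · exact ⟨0, fun h => absurd h hmem⟩
    choose k hk using this
    obtain ⟨K, hK⟩ := ((hfin η hη).image k).bddAbove
    obtain ⟨ν, hν, hlen, ⟨l, rfl⟩, hlt⟩ := h (max K (η.length + 1))
    cases l with
    | nil => simp at hlen
    | cons n l =>
      have hpre : η ++ [n] <+: η ++ n :: l := ⟨l, by simp⟩
      have hmem : η ++ [n] ∈ p.tree := p.prefix_closed _ _ hν hpre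
      have hkK : k n ≤ K := hK ⟨n, hmem, rfl⟩
      exact absurd (hk n hmem _ hν (hkK.trans ((le_max_left _ _).trans hlen)) hpre) (not_le.2 hlt)
  obtain ⟨x, hx⟩ := exists_branch (A := A) ⟨p.nil_mem, fun k => by
    obtain ⟨ν, hν, h1, h2⟩ := hcon k
    exact ⟨ν, hν, h1, List.nil_prefix, h2⟩⟩ hA
  -- No node of the branch is in the set required by divergence, although all but finitely many
  -- should be.
  refine Set.infinite_range_of_injective (f := fun k => (List.range k).map x) ?_
    ((hdiv m x fun k => (hx k).1).subset ?_)
  · intro i j h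
    simpa using congrArg List.length h
  · rintro _ ⟨k, rfl⟩
    refine ⟨⟨k, rfl⟩, fun h => ?_⟩
    obtain ⟨ν, hν, -, hpre, hlt⟩ := (hx k).2 0
    exact absurd (h.2 ν hν hpre) (not_le.2 hlt)

end LT

/-- `T` is a subtree of the tree of `p` without terminal nodes, on which the norms computed with
the measures of `p` tend to infinity. -/
structure IsSubtree (p : LT) (T : Set (List ℕ)) : Prop where
  subset : T ⊆ p.tree
  nil_mem : [] ∈ T
  prefix_closed : ∀ η ν : List ℕ, ν ∈ T → η <+: ν → η ∈ T
  succs_nonempty : ∀ η ∈ T, (succs T η).Nonempty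
  diverges : ∀ m, ∃ k, ∀ ν ∈ T, k ≤ ν.length → m ≤ p.meas ν (succs T ν)

/-- `T` has a splitting node. -/
def Splits (T : Set (List ℕ)) : Prop := ∃ s ∈ T, (succs T s).Nontrivial

theorem isSubtree_tree (p : LTfd) : IsSubtree p.1 p.1.tree where
  subset := subset_rfl
  nil_mem := p.1.nil_mem
  prefix_closed := p.1.prefix_closed
  succs_nonempty := p.1.succs_nonempty
  diverges := p.1.exists_level p.2.1 p.2.2

namespace IsSubtree

variable {p q : LT} {T : Set (List ℕ)}

theorem of_le (hpq : p ≤ q) (h : IsSubtree q T) : IsSubtree p T where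
  subset := h.subset.trans hpq.1
  nil_mem := h.nil_mem
  prefix_closed := h.prefix_closed
  succs_nonempty := h.succs_nonempty
  diverges m := by
    obtain ⟨k, hk⟩ := h.diverges m
    exact ⟨k, fun ν hν hkν => (hk ν hν hkν).trans (LT.meas_le_of_le hpq _ _)⟩

/-- Each subtree that splits is the tree of a stronger condition. -/
theorem exists_condition {p : LTfd} (h : IsSubtree p.1 T) (hs : Splits T) :
    ∃ q : LTfd, p ≤ q ∧ q.1.tree = T := by
  classical
  have hsub : ∀ η, succs T η ⊆ succs p.1.tree η := fun η n hn => h.subset hn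
  obtain ⟨s, hs⟩ := exists_isStem h.prefix_closed hs
  let q : LT :=
    { tree := T
      meas := fun η S => if η ∈ ess T ∧ S.Nonempty ∧ S ⊆ succs T η then p.1.meas η S else 0
      prefix_closed := h.prefix_closed
      succs_nonempty := h.succs_nonempty
      exists_stem := ⟨s, hs⟩
      isLogMeasure := fun η hη => by
        have hL := p.1.isLogMeasure η (ess_subset_ess h.subset p.1.exists_stem hη)
        constructor
        · intro x y hx hxy hy
          rw [if_pos ⟨hη, hx, hxy.trans hy⟩, if_pos ⟨hη, hx.mono hxy, hy⟩]
          exact hL.mono x y hx hxy (hy.trans (hsub η))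
        · intro x y hx hy hx' hy'
          rw [if_pos ⟨hη, hx.mono Set.subset_union_left, Set.union_subset hx' hy'⟩,
            if_pos ⟨hη, hx, hx'⟩, if_pos ⟨hη, hy, hy'⟩]
          exact hL.split x y hx hy (hx'.trans (hsub η)) (hy'.trans (hsub η))
      meas_eq_zero := fun η S hc => if_neg hc }
  have hpq : p.1 ≤ q := ⟨h.subset, fun η hη S hS hS' => if_pos ⟨hη, hS, hS'⟩⟩
  refine ⟨⟨q, fun η hη => (p.2.1 η (h.subset hη)).subset (hsub η), fun m x hx => ?_⟩, hpq, rfl⟩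
  obtain ⟨k, hk⟩ := h.diverges m
  -- The level must also be past the stem, since below it the new measure has the default value 0.
  refine (Set.finite_range fun i : Fin (max k s.length) => (List.range i).map x).subset ?_
  rintro _ ⟨⟨i, rfl⟩, hi⟩
  refine ⟨⟨i, ?_⟩, rfl⟩
  by_contra! hle
  refine hi ⟨hx i, fun ν hν hpre => ?_⟩
  have hlen : i ≤ ν.length := by simpa using hpre.length_le
  have hess : ν ∈ ess T :=
    mem_ess_of_length_le hs hν ((le_max_right _ _).trans (hle.trans hlen))
  calc m ≤ p.1.meas ν (succs T ν) := hk ν hν ((le_max_left _ _).trans (hle.trans hlen))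
    _ = q.meas ν (succs T ν) := (if_pos ⟨hess, h.succs_nonempty ν hν, subset_rfl⟩).symm

end IsSubtree

theorem mem_succs_of_prefix {T : Set (List ℕ)}
    (hT : ∀ η ν : List ℕ, ν ∈ T → η <+: ν → η ∈ T) {η : List ℕ} {n : ℕ} {l : List ℕ}
    (h : η ++ n :: l ∈ T) : n ∈ succs T η :=
  hT _ _ h ⟨l, by simp⟩

theorem eq_of_concat_prefix {η ν : List ℕ} {m n : ℕ} (hm : η ++ [m] <+: ν)
    (hn : η ++ [n] <+: ν) : m = n := by
  have := (List.prefix_of_prefix_length_le hm hn (by simp)).eq_of_length (by simp)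
  simpa using this

/-- The nodes of `T` comparable with `η`. -/
def cone (T : Set (List ℕ)) (η : List ℕ) : Set (List ℕ) := {ν ∈ T | ν <+: η ∨ η <+: ν}

namespace IsSubtree

variable {p : LT} {T : Set (List ℕ)}

theorem exists_mem_length (h : IsSubtree p T) {η : List ℕ} (hη : η ∈ T) {k : ℕ}
    (hk : η.length ≤ k) : ∃ ν ∈ T, η <+: ν ∧ ν.length = k := by
  induction k, hk using Nat.le_induction with
  | base => exact ⟨η, hη, List.prefix_rfl, rfl⟩
  | succ k _ ih =>
    obtain ⟨ν, hν, hην, rfl⟩ := ih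
    obtain ⟨n, hn⟩ := h.succs_nonempty ν hν
    exact ⟨ν ++ [n], hn, hην.trans (List.prefix_append _ _), by simp⟩

theorem cone (h : IsSubtree p T) {η : List ℕ} (hη : η ∈ T) : IsSubtree p (cone T η) where
  subset := fun ν hν => h.subset hν.1
  nil_mem := ⟨h.nil_mem, Or.inl List.nil_prefix⟩
  prefix_closed := by
    rintro μ ν ⟨hν, hνη⟩ hμν
    refine ⟨h.prefix_closed _ _ hν hμν, ?_⟩
    rcases hνη with hνη | hνη
    · exact Or.inl (hμν.trans hνη)
    · exact List.prefix_or_prefix_of_prefix hμν hνη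
  succs_nonempty := by
    rintro ν ⟨hν, hνη⟩
    by_cases hην : η <+: ν
    · obtain ⟨n, hn⟩ := h.succs_nonempty ν hν
      exact ⟨n, hn, Or.inr (hην.trans (List.prefix_append _ _))⟩
    · obtain ⟨l, rfl⟩ := hνη.resolve_right hην
      cases l with
      | nil => simp at hην
      | cons n l => exact ⟨n, mem_succs_of_prefix h.prefix_closed hη, Or.inl ⟨l, by simp⟩⟩
  diverges m := by
    obtain ⟨k, hk⟩ := h.diverges m
    refine ⟨max k η.length, fun ν hν hkν => ?_⟩
    have hην : η <+: ν := by
      rcases hν.2 with h' | h'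
      · rw [h'.eq_of_length_le ((le_max_right _ _).trans hkν)]
      · exact h'
    refine (hk ν hν.1 ((le_max_left _ _).trans hkν)).trans_eq (congrArg _ ?_)
    ext n
    exact ⟨fun hn => ⟨hn, Or.inr (hην.trans (List.prefix_append _ _))⟩, fun hn => hn.1⟩

theorem union {T₁ T₂ : Set (List ℕ)} (h₁ : IsSubtree p T₁) (h₂ : IsSubtree p T₂) :
    IsSubtree p (T₁ ∪ T₂) where
  subset := Set.union_subset h₁.subset h₂.subset
  nil_mem := Or.inl h₁.nil_mem
  prefix_closed η ν hν h := hν.imp (h₁.prefix_closed η ν · h) (h₂.prefix_closed η ν · h)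
  succs_nonempty := by
    rintro η (h | h)
    · exact (h₁.succs_nonempty η h).mono fun n hn => Or.inl hn
    · exact (h₂.succs_nonempty η h).mono fun n hn => Or.inr hn
  diverges m := by
    obtain ⟨k₁, hk₁⟩ := h₁.diverges m
    obtain ⟨k₂, hk₂⟩ := h₂.diverges m
    have hsub : ∀ ν, succs (T₁ ∪ T₂) ν ⊆ succs p.tree ν := fun ν n hn =>
      Set.union_subset h₁.subset h₂.subset hn
    refine ⟨max k₁ k₂, fun ν hν hk => ?_⟩
    rcases hν with hν | hν
    · exact (hk₁ ν hν ((le_max_left _ _).trans hk)).trans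
        (LT.meas_mono (fun n hn => Or.inl hn) (hsub ν))
    · exact (hk₂ ν hν ((le_max_right _ _).trans hk)).trans
        (LT.meas_mono (fun n hn => Or.inr hn) (hsub ν))

end IsSubtree

/-- Each subtree of `p` with diverging norms splits, hence is the tree of a condition. -/
def IsRich (p : LT) : Prop := ∀ T, IsSubtree p T → Splits T

theorem IsRich.of_le {p q : LT} (hp : IsRich p) (hpq : p ≤ q) : IsRich q :=
  fun T hT => hp T (hT.of_le hpq)

/-! ### Threads, maximal conditions and rich conditions. -/

section Thread

/-! A *thread* is a subtree without splitting nodes. -/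

variable {p : LT} {T T₁ T₂ : Set (List ℕ)}

theorem succ_unique_of_not_splits (hs : ¬ Splits T) {η : List ℕ} (hη : η ∈ T) {m n : ℕ}
    (hm : η ++ [m] ∈ T) (hn : η ++ [n] ∈ T) : m = n := by
  by_contra hmn
  exact hs ⟨η, hη, m, hm, n, hn, hmn⟩

theorem prefix_or_prefix_of_not_splits (hT : ∀ η ν : List ℕ, ν ∈ T → η <+: ν → η ∈ T)
    (hs : ¬ Splits T) {η ν : List ℕ} (hη : η ∈ T) (hν : ν ∈ T) : η <+: ν ∨ ν <+: η := by
  induction η using List.reverseRecOn with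
  | nil => exact Or.inl List.nil_prefix
  | append_singleton η n ih =>
    have hη' := hT _ _ hη (List.prefix_append _ _)
    rcases ih hη' with ⟨l, rfl⟩ | h
    · cases l with
      | nil => exact Or.inr (by simp)
      | cons m l =>
        rw [succ_unique_of_not_splits hs hη' hη (mem_succs_of_prefix hT hν)]
        exact Or.inl ⟨l, by simp⟩
    · exact Or.inr (h.trans (List.prefix_append _ _))

theorem IsSubtree.eq_of_subset_of_not_splits (h₁ : IsSubtree p T₁)
    (hT : ∀ η ν : List ℕ, ν ∈ T → η <+: ν → η ∈ T) (hs : ¬ Splits T) (h : T₁ ⊆ T) :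
    T₁ = T := by
  refine h.antisymm fun η hη => ?_
  induction η using List.reverseRecOn with
  | nil => exact h₁.nil_mem
  | append_singleton η n ih =>
    have hη' := hT _ _ hη (List.prefix_append _ _)
    obtain ⟨m, hm⟩ := h₁.succs_nonempty η (ih hη')
    rw [succ_unique_of_not_splits hs hη' hη (h hm)]
    exact hm

/-- Past `u` the tree of `r` cannot use nodes of `T₂`, so it must follow the only branch of `T₁`. -/
theorem subset_of_mem_thread {r : LT} (h₁ : IsSubtree p T₁) (h₂ : IsSubtree p T₂)
    (hs₁ : ¬ Splits T₁) (hr : r.tree ⊆ T₁ ∪ T₂) {u : List ℕ} (hu : u ∈ r.tree) (hu₁ : u ∈ T₁)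
    (hu₂ : u ∉ T₂) : T₁ ⊆ r.tree := by
  intro η hη
  rcases prefix_or_prefix_of_not_splits h₁.prefix_closed hs₁ hη hu₁ with h | ⟨l, rfl⟩
  · exact r.prefix_closed _ _ hu h
  · induction l using List.reverseRecOn with
    | nil => simpa using hu
    | append_singleton l n ih =>
      rw [← List.append_assoc] at hη ⊢
      have hη' := h₁.prefix_closed _ _ hη (List.prefix_append _ _)
      obtain ⟨m, hm⟩ := r.succs_nonempty _ (ih hη')
      rcases hr hm with hm₁ | hm₂
      · rw [succ_unique_of_not_splits hs₁ hη' hη hm₁]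
        exact hm
      · refine absurd (h₂.prefix_closed _ _ hm₂ ?_) hu₂
        rw [List.append_assoc]
        exact List.prefix_append _ _

/-- The union of two threads is the tree of a maximal condition. -/
theorem exists_isMax_of_threads {p : LTfd} (h₁ : IsSubtree p.1 T₁) (h₂ : IsSubtree p.1 T₂)
    (hs₁ : ¬ Splits T₁) (hs₂ : ¬ Splits T₂) (hne : T₁ ≠ T₂) : ∃ q, p ≤ q ∧ IsMax q := by
  have hU := h₁.union h₂
  have hs : Splits (T₁ ∪ T₂) := by
    by_contra hs
    exact hne ((h₁.eq_of_subset_of_not_splits hU.prefix_closed hs Set.subset_union_left).trans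
      (h₂.eq_of_subset_of_not_splits hU.prefix_closed hs Set.subset_union_right).symm)
  obtain ⟨q, hpq, hq⟩ := hU.exists_condition hs
  refine ⟨q, hpq, fun r hqr => LT.le_of_tree_subset hqr le_rfl ?_⟩
  have hr : r.1.tree ⊆ T₁ ∪ T₂ := hq ▸ hqr.1
  have key : ∀ (s : List ℕ) (m n : ℕ), m ≠ n → s ++ [m] ∈ r.1.tree → s ++ [n] ∈ r.1.tree →
      s ++ [m] ∈ T₁ → s ++ [n] ∈ T₂ → T₁ ∪ T₂ ⊆ r.1.tree := by
    intro s m n hmn hm hn hm₁ hn₂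
    have hs₁' := h₁.prefix_closed _ _ hm₁ (List.prefix_append _ _)
    have hs₂' := h₂.prefix_closed _ _ hn₂ (List.prefix_append _ _)
    refine Set.union_subset ?_ ?_
    · exact subset_of_mem_thread h₁ h₂ hs₁ hr hm hm₁ fun hm₂ =>
        hmn (succ_unique_of_not_splits hs₂ hs₂' hm₂ hn₂)
    · exact subset_of_mem_thread h₂ h₁ hs₂ (Set.union_comm T₁ T₂ ▸ hr) hn hn₂ fun hn₁ =>
        hmn (succ_unique_of_not_splits hs₁ hs₁' hm₁ hn₁)
  -- Any extension `r` splits at its stem. A thread does not split, so the two successors lie in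
  -- different threads, which forces `r` to contain both.
  obtain ⟨s, hsr, -, m, hm, n, hn, hmn⟩ := r.1.exists_stem
  rw [hq]
  rcases hr hm with hm' | hm' <;> rcases hr hn with hn' | hn'
  · exact absurd (succ_unique_of_not_splits hs₁
      (h₁.prefix_closed _ _ hm' (List.prefix_append _ _)) hm' hn') hmn
  · exact key s m n hmn hm hn hm' hn'
  · exact key s n m hmn.symm hn hm hn' hm'
  · exact absurd (succ_unique_of_not_splits hs₂
      (h₂.prefix_closed _ _ hm' (List.prefix_append _ _)) hm' hn') hmn

/-- Above each condition, there is one which is maximal or rich. -/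
theorem exists_isMax_or_isRich (p : LTfd) : ∃ q, p ≤ q ∧ (IsMax q ∨ IsRich q.1) := by
  by_cases h : ∃ T₁ T₂, IsSubtree p.1 T₁ ∧ IsSubtree p.1 T₂ ∧ ¬ Splits T₁ ∧ ¬ Splits T₂ ∧ T₁ ≠ T₂
  · obtain ⟨T₁, T₂, h₁, h₂, hs₁, hs₂, hne⟩ := h
    obtain ⟨q, hpq, hq⟩ := exists_isMax_of_threads h₁ h₂ hs₁ hs₂ hne
    exact ⟨q, hpq, Or.inl hq⟩
  push Not at h
  have hp := isSubtree_tree p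
  have key : ∀ u ∈ p.1.tree,
      (∀ T ⊆ cone p.1.tree u, IsSubtree p.1 T → Splits T) → ∃ q, p ≤ q ∧ IsRich q.1 := by
    intro u hu hT
    obtain ⟨q, hpq, hq⟩ := (hp.cone hu).exists_condition (hT _ subset_rfl (hp.cone hu))
    exact ⟨q, hpq, fun T hT' => hT T (hq ▸ hT'.subset) (hT'.of_le hpq)⟩
  suffices ∃ q, p ≤ q ∧ IsRich q.1 from this.imp fun q hq => ⟨hq.1, Or.inr hq.2⟩
  -- Threads in the cones of two different successors of the stem would be different, but at most
  -- one thread exists; hence one of the cones is rich.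
  obtain ⟨s, -, -, m, hm, n, hn, hmn⟩ := p.1.exists_stem
  by_contra hcon
  have hthread : ∀ u ∈ p.1.tree, ∃ T ⊆ cone p.1.tree u, IsSubtree p.1 T ∧ ¬ Splits T := by
    intro u hu
    by_contra! hT
    exact hcon (key u hu hT)
  have hmem : ∀ (u : List ℕ) (T : Set (List ℕ)), T ⊆ cone p.1.tree u → IsSubtree p.1 T →
      u ∈ T := by
    intro u T hTu hT
    obtain ⟨ν, hν, -, hlen⟩ := hT.exists_mem_length hT.nil_mem (Nat.zero_le u.length)
    rcases (hTu hν).2 with h' | h'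
    · exact h'.eq_of_length hlen ▸ hν
    · exact h'.eq_of_length hlen.symm ▸ hν
  obtain ⟨T₁, hT₁, h₁, hs₁⟩ := hthread _ hm
  obtain ⟨T₂, hT₂, h₂, hs₂⟩ := hthread _ hn
  have hm₁ := hmem _ _ hT₁ h₁
  have hn₁ := hmem _ _ hT₂ h₂
  rw [← h T₁ T₂ h₁ h₂ hs₁ hs₂] at hn₁
  exact hmn (succ_unique_of_not_splits hs₁ (h₁.prefix_closed _ _ hm₁ (List.prefix_append _ _))
    hm₁ hn₁)

end Thread

/-! ### Pure decision. -/

section PureDecision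

/-- The node `η` is *good* if some tree with root `η` below `q`, full below the level `k` and with
norms at least `n` from then on, has a front that consists of nodes of conditions in `D`. -/
inductive IsGood (q : LTfd) (D : Set LTfd) (k n : ℕ) : List ℕ → Prop
  | base (η : List ℕ) (r : LTfd) (hr : r ∈ D) (hqr : q ≤ r) (hη : η ∈ r.1.tree)
      (hk : k ≤ η.length)
      (hn : ∀ ν ∈ r.1.tree, η <+: ν → n ≤ q.1.meas ν (succs r.1.tree ν)) : IsGood q D k n η
  | step (η : List ℕ) (A : Set ℕ) (hη : η ∈ q.1.tree) (hA : A ⊆ succs q.1.tree η)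
      (hne : A.Nonempty) (hlt : η.length < k → A = succs q.1.tree η)
      (hle : k ≤ η.length → n ≤ q.1.meas η A) (h : ∀ m ∈ A, IsGood q D k n (η ++ [m])) :
      IsGood q D k n η

variable {q : LTfd} {D : Set LTfd} {k n : ℕ}

/-- Otherwise the hereditarily bad nodes above `η`, with the nodes below `η`, form a subtree whose
norms drop by at most 1. By richness it is a condition; an extension in `D` makes one of its own
high nodes good. -/
theorem isGood_of_le_length (hq : IsRich q.1) (hD : IsDenseOpen D)
    (hn : ∀ ν ∈ q.1.tree, k ≤ ν.length → n + 1 ≤ q.1.norm ν) {η : List ℕ} (hη : η ∈ q.1.tree)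
    (hk : k ≤ η.length) : IsGood q D k n η := by
  by_contra hbad
  let T : Set (List ℕ) := {ν | ν ∈ q.1.tree ∧ (ν <+: η ∨ η <+: ν) ∧
    ∀ μ, η <+: μ → μ <+: ν → ¬ IsGood q D k n μ}
  have hηT : η ∈ T := ⟨hη, Or.inl List.prefix_rfl, fun μ h1 h2 => by
    rwa [h2.eq_of_length_le h1.length_le]⟩
  have hclosed : ∀ μ ν : List ℕ, ν ∈ T → μ <+: ν → μ ∈ T := by
    rintro μ ν ⟨hν, hcomp, hν'⟩ hμν
    refine ⟨q.1.prefix_closed _ _ hν hμν, ?_, fun σ h1 h2 => hν' σ h1 (h2.trans hμν)⟩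
    rcases hcomp with h | h
    · exact Or.inl (hμν.trans h)
    · exact List.prefix_or_prefix_of_prefix hμν h
  have hsucc : ∀ ν ∈ T, η <+: ν →
      succs T ν = {m ∈ succs q.1.tree ν | ¬ IsGood q D k n (ν ++ [m])} := by
    rintro ν ⟨hν, -, hν'⟩ hην
    ext m
    constructor
    · rintro ⟨h1, -, h2⟩
      exact ⟨h1, h2 _ (hην.trans (List.prefix_append _ _)) List.prefix_rfl⟩
    · rintro ⟨h1, h2⟩
      refine ⟨h1, Or.inr (hην.trans (List.prefix_append _ _)), fun μ hημ hμ => ?_⟩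
      rcases List.prefix_concat_iff.1 hμ with rfl | hμ
      · exact h2
      · exact hν' μ hημ hμ
  have hnorm : ∀ ν ∈ T, η <+: ν →
      (succs T ν).Nonempty ∧ q.1.norm ν ≤ q.1.meas ν (succs T ν) + 1 := by
    intro ν hνT hην
    have hν := hνT.1
    have hkν : k ≤ ν.length := hk.trans hην.length_le
    have hnν : n + 1 ≤ q.1.norm ν := hn ν hν hkν
    rw [hsucc ν hνT hην]
    let A : Set ℕ := {m ∈ succs q.1.tree ν | IsGood q D k n (ν ++ [m])}
    let B : Set ℕ := {m ∈ succs q.1.tree ν | ¬ IsGood q D k n (ν ++ [m])}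
    change B.Nonempty ∧ q.1.norm ν ≤ q.1.meas ν B + 1
    have hAB : A ∪ B = succs q.1.tree ν := by
      ext m
      by_cases h : IsGood q D k n (ν ++ [m]) <;> simp [A, B, h]
    rcases A.eq_empty_or_nonempty with hA | hA
    · rw [hA, Set.empty_union] at hAB
      rw [hAB]
      exact ⟨q.1.succs_nonempty ν hν, Nat.le_succ _⟩
    · have hAn : q.1.meas ν A < n := by
        by_contra! hle
        exact hνT.2.2 ν hην List.prefix_rfl
          (.step ν A hν (fun m hm => hm.1) hA (fun h => absurd h (not_lt.2 hkν)) (fun _ => hle)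
            fun m hm => hm.2)
      have hB : B.Nonempty := by
        by_contra! hB
        rw [hB, Set.union_empty] at hAB
        rw [hAB] at hAn
        exact absurd hnν (not_le.2 (hAn.trans n.lt_succ_self))
      have hess := (LT.mem_ess_of_meas_pos (n.succ_pos.trans_le hnν)).1
      refine ⟨hB, ?_⟩
      have := (q.1.isLogMeasure ν hess).split A B hA hB (fun m hm => hm.1) (fun m hm => hm.1)
      rw [hAB] at this
      change q.1.norm ν ≤ _ ∨ q.1.norm ν ≤ _ at this
      omega
  have hT : IsSubtree q.1 T :=
    { subset := fun ν hν => hν.1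
      nil_mem := hclosed _ _ hηT List.nil_prefix
      prefix_closed := hclosed
      succs_nonempty := fun ν hν => by
        by_cases hην : η <+: ν
        · exact (hnorm ν hν hην).1
        · obtain ⟨l, rfl⟩ := hν.2.1.resolve_right hην
          cases l with
          | nil => simp at hην
          | cons m l => exact ⟨m, mem_succs_of_prefix hclosed hηT⟩
      diverges := fun m => by
        obtain ⟨K, hK⟩ := q.1.exists_level q.2.1 q.2.2 (m + 1)
        refine ⟨max K η.length, fun ν hν hKν => ?_⟩
        have hην : η <+: ν := by
          rcases hν.2.1 with h | h
          · rw [h.eq_of_length_le ((le_max_right _ _).trans hKν)]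
          · exact h
        have h1 := hK ν hν.1 ((le_max_left _ _).trans hKν)
        have h2 := (hnorm ν hν hην).2
        omega }
  obtain ⟨r₀, hqr₀, hr₀⟩ := hT.exists_condition (hq T hT)
  obtain ⟨r, hr, hr₀r⟩ := hD.dense r₀
  have hqr := hqr₀.trans hr₀r
  have hrT := (isSubtree_tree r).of_le hqr
  -- Beyond level `K` the norms of `r` are at least `n`, so a node of `r` there is good by the base
  -- case.
  obtain ⟨K, hK⟩ := hrT.diverges n
  obtain ⟨ν, hν, -, hlen⟩ := hrT.exists_mem_length hrT.nil_mem (Nat.zero_le (max K η.length))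
  have hνT : ν ∈ T := hr₀ ▸ hr₀r.1 hν
  have hην : η <+: ν := by
    rcases hνT.2.1 with h | h
    · rw [h.eq_of_length_le ((le_max_right _ _).trans hlen.ge)]
    · exact h
  exact hνT.2.2 ν hην List.prefix_rfl (.base ν r hr hqr hν (hk.trans hην.length_le)
    fun μ hμ hνμ => hK μ hμ ((le_max_left _ _).trans (hlen.ge.trans hνμ.length_le)))

/-- Below level `k` all successors are kept, so goodness passes down from level `k` to the root. -/
theorem isGood_nil (hq : IsRich q.1) (hD : IsDenseOpen D)
    (hn : ∀ ν ∈ q.1.tree, k ≤ ν.length → n + 1 ≤ q.1.norm ν) : IsGood q D k n [] := by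
  have : ∀ j, ∀ η ∈ q.1.tree, k ≤ η.length + j → IsGood q D k n η := by
    intro j
    induction j with
    | zero => exact fun η hη h => isGood_of_le_length hq hD hn hη h
    | succ j ih =>
      intro η hη h
      by_cases hk : k ≤ η.length
      · exact isGood_of_le_length hq hD hn hη hk
      · refine .step η (succs q.1.tree η) hη subset_rfl (q.1.succs_nonempty η hη) (fun _ => rfl)
          (fun h => absurd h hk) fun m hm => ih _ hm ?_
        rw [List.length_append, List.length_singleton]
        omega
  exact this k [] q.1.nil_mem (by simp)

/-- `T` is the part above `η` of a subtree of `p`. -/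
structure IsSubtreeAt (p : LT) (η : List ℕ) (T : Set (List ℕ)) : Prop where
  subset : T ⊆ p.tree
  root_mem : η ∈ T
  root_prefix : ∀ ν ∈ T, η <+: ν
  prefix_closed : ∀ μ ν : List ℕ, ν ∈ T → η <+: μ → μ <+: ν → μ ∈ T
  succs_nonempty : ∀ ν ∈ T, (succs T ν).Nonempty
  diverges : ∀ m, ∃ k, ∀ ν ∈ T, k ≤ ν.length → m ≤ p.meas ν (succs T ν)

/-- Induction on the derivation of goodness: glue the trees obtained at the successors. -/
theorem IsGood.exists_subtree {η : List ℕ} (h : IsGood q D k n η) :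
    ∃ (T : Set (List ℕ)) (K : ℕ), IsSubtreeAt q.1 η T ∧
      (∀ ν ∈ T, ν.length < k → succs T ν = succs q.1.tree ν) ∧
      (∀ ν ∈ T, k ≤ ν.length → n ≤ q.1.meas ν (succs T ν)) ∧
      ∀ ν ∈ T, K ≤ ν.length → ∃ r ∈ D, q ≤ r ∧ ∀ μ ∈ T, ν <+: μ → μ ∈ r.1.tree := by
  induction h with
  | base η r hr hqr hη hk hn =>
    have hsucc : ∀ ν, η <+: ν →
        succs {ν | ν ∈ r.1.tree ∧ η <+: ν} ν = succs r.1.tree ν := fun ν hην => by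
      ext m
      exact ⟨fun h => h.1, fun h => ⟨h, hην.trans (List.prefix_append _ _)⟩⟩
    refine ⟨{ν | ν ∈ r.1.tree ∧ η <+: ν}, 0, ⟨fun ν hν => hqr.1 hν.1, ⟨hη, List.prefix_rfl⟩,
      fun ν hν => hν.2, fun μ ν hν hημ hμν => ⟨r.1.prefix_closed _ _ hν.1 hμν, hημ⟩, ?_, ?_⟩,
      ?_, ?_, ?_⟩
    · rintro ν ⟨hν, hην⟩
      rw [hsucc ν hην]
      exact r.1.succs_nonempty ν hν
    · intro m
      obtain ⟨K, hK⟩ := ((isSubtree_tree r).of_le hqr).diverges m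
      refine ⟨K, ?_⟩
      rintro ν ⟨hν, hην⟩ hKν
      rw [hsucc ν hην]
      exact hK ν hν hKν
    · rintro ν ⟨-, hην⟩ hν
      exact absurd (hk.trans hην.length_le) (not_le.2 hν)
    · rintro ν ⟨hν, hην⟩ -
      rw [hsucc ν hην]
      exact hn ν hν hην
    · exact fun ν _ _ => ⟨r, hr, hqr, fun μ hμ _ => hμ.1⟩
  | step η A hη hA hne hlt hle _ ih =>
    choose! S K hS hSlt hSle hSD using ih
    have hAfin : A.Finite := (q.2.1 η hη).subset hA
    let T : Set (List ℕ) := {ν | ν = η ∨ ∃ m ∈ A, ν ∈ S m}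
    have hmem : ∀ m ∈ A, ∀ ν ∈ T, η ++ [m] <+: ν → ν ∈ S m := by
      rintro m hm ν (rfl | ⟨m', hm', hν⟩) hpre
      · simpa using hpre.length_le
      · rwa [eq_of_concat_prefix hpre ((hS m' hm').root_prefix ν hν)]
    have hsucc : ∀ m ∈ A, ∀ ν ∈ S m, succs T ν = succs (S m) ν := by
      intro m hm ν hν
      ext j
      exact ⟨fun hj => hmem m hm _ hj (((hS m hm).root_prefix ν hν).trans (List.prefix_append _ _)),
        fun hj => Or.inr ⟨m, hm, hj⟩⟩
    have hsuccη : succs T η = A := by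
      ext j
      constructor
      · rintro (h | ⟨m, hm, h⟩)
        · simp at h
        · rwa [eq_of_concat_prefix List.prefix_rfl ((hS m hm).root_prefix _ h)]
      · exact fun hj => Or.inr ⟨j, hj, (hS j hj).root_mem⟩
    -- Finitely many successors allow a common level; taking it above the length of `η` exempts the
    -- root `η` itself.
    have hbound : ∀ f : ℕ → ℕ, ∃ M, η.length < M ∧ ∀ m ∈ A, f m ≤ M := fun f => by
      obtain ⟨M, hM⟩ := (hAfin.image f).bddAbove
      exact ⟨max M (η.length + 1), lt_max_of_lt_right (Nat.lt_succ_self _),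
        fun m hm => (hM ⟨m, hm, rfl⟩).trans (le_max_left _ _)⟩
    obtain ⟨M, hηM, hM⟩ := hbound K
    refine ⟨T, M, ⟨?_, Or.inl rfl, ?_, ?_, ?_, ?_⟩, ?_, ?_, ?_⟩
    · rintro ν (rfl | ⟨m, hm, hν⟩)
      · exact hη
      · exact (hS m hm).subset hν
    · rintro ν (rfl | ⟨m, hm, hν⟩)
      · exact List.prefix_rfl
      · exact (List.prefix_append _ _).trans ((hS m hm).root_prefix ν hν)
    · rintro μ ν (rfl | ⟨m, hm, hν⟩) hημ hμν
      · exact Or.inl (hμν.eq_of_length_le hημ.length_le)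
      · rcases List.prefix_or_prefix_of_prefix hμν ((hS m hm).root_prefix ν hν) with h | h
        · rcases List.prefix_concat_iff.1 h with rfl | h
          · exact Or.inr ⟨m, hm, (hS m hm).root_mem⟩
          · exact Or.inl (h.eq_of_length_le hημ.length_le)
        · exact Or.inr ⟨m, hm, (hS m hm).prefix_closed μ ν hν h hμν⟩
    · rintro ν (rfl | ⟨m, hm, hν⟩)
      · rwa [hsuccη]
      · rw [hsucc m hm ν hν]
        exact (hS m hm).succs_nonempty ν hν
    · intro i
      have := fun m (hm : m ∈ A) => (hS m hm).diverges i
      choose! f hf using this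
      obtain ⟨L, hηL, hL⟩ := hbound f
      refine ⟨L, ?_⟩
      rintro ν (rfl | ⟨m, hm, hν⟩) hLν
      · exact absurd hLν (not_le.2 hηL)
      · rw [hsucc m hm ν hν]
        exact hf m hm ν hν ((hL m hm).trans hLν)
    · rintro ν (rfl | ⟨m, hm, hν⟩) hk
      · rw [hsuccη, hlt hk]
      · rw [hsucc m hm ν hν, hSlt m hm ν hν hk]
    · rintro ν (rfl | ⟨m, hm, hν⟩) hk
      · rw [hsuccη]
        exact hle hk
      · rw [hsucc m hm ν hν]
        exact hSle m hm ν hν hk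
    · rintro ν (rfl | ⟨m, hm, hν⟩) hMν
      · exact absurd hMν (not_le.2 hηM)
      · obtain ⟨r, hr, hqr, h⟩ := hSD m hm ν hν ((hM m hm).trans hMν)
        exact ⟨r, hr, hqr, fun μ hμ hνμ =>
          h μ (hmem m hm μ hμ (((hS m hm).root_prefix ν hν).trans hνμ)) hνμ⟩

/-- Pure decision: a rich condition whose norms from the level `k` on are greater than `n` can be
strengthened, keeping the nodes up to the level `k` and norms at least `n`, such that all
restrictions to the nodes of a high level are in `D`. -/
theorem exists_pure_extension (hq : IsRich q.1) (hD : IsDenseOpen D)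
    (hn : ∀ ν ∈ q.1.tree, k ≤ ν.length → n + 1 ≤ q.1.norm ν) :
    ∃ (r : LTfd) (K : ℕ), q ≤ r ∧ (∀ ν ∈ q.1.tree, ν.length ≤ k → ν ∈ r.1.tree) ∧
      (∀ ν ∈ r.1.tree, k ≤ ν.length → n ≤ q.1.meas ν (succs r.1.tree ν)) ∧
      ∀ d, r ≤ d → ∀ ν, K ≤ ν.length → ν ∈ r.1.tree → d.1.tree = cone r.1.tree ν → d ∈ D := by
  obtain ⟨T, K, hT, hlt, hle, hTD⟩ := (isGood_nil hq hD hn).exists_subtree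
  have hT' : IsSubtree q.1 T :=
    ⟨hT.subset, hT.root_mem, fun μ ν hν h => hT.prefix_closed μ ν hν List.nil_prefix h,
      hT.succs_nonempty, hT.diverges⟩
  obtain ⟨r, hqr, rfl⟩ := hT'.exists_condition (hq _ hT')
  refine ⟨r, K, hqr, fun ν => ?_, hle, fun d hrd ν hν hνr hd => ?_⟩
  · induction ν using List.reverseRecOn with
    | nil => exact fun _ _ => r.1.nil_mem
    | append_singleton ν m ih =>
      intro hνq hlen
      rw [List.length_append, List.length_singleton] at hlen
      have hνr := ih (q.1.prefix_closed _ _ hνq (List.prefix_append _ _)) (by omega)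
      have : m ∈ succs q.1.tree ν := hνq
      rw [← hlt ν hνr (by omega)] at this
      exact this
  · obtain ⟨e, he, hqe, hre⟩ := hTD ν hνr hν
    refine hD.isOpen e he d (LT.le_of_tree_subset hqe (hqr.trans hrd) ?_)
    rw [hd]
    rintro μ ⟨hμ, hμν | hνμ⟩
    · exact e.1.prefix_closed _ _ (hre ν hνr List.prefix_rfl) hμν
    · exact hre μ hμ hνμ

end PureDecision

/-! ### Fusion of rich conditions. -/

/-- The states of the fusion: a condition with a level and a bound for the norms. -/
abbrev FusionState : Type := LTfd × ℕ × ℕ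

namespace FusionState

/-- The tree is rich, and from the given level on its norms are greater than the given bound. -/
structure IsValid (s : FusionState) : Prop where
  isRich : IsRich s.1.1
  lt_norm : ∀ ν ∈ s.1.1.tree, s.2.1 ≤ ν.length → s.2.2 + 1 ≤ s.1.1.norm ν

/-- The restrictions of the condition to the nodes of the given level. -/
def front (s : FusionState) : Set LTfd :=
  {d | s.1 ≤ d ∧ ∃ ν ∈ s.1.1.tree, ν.length = s.2.1 ∧ d.1.tree = cone s.1.1.tree ν}

/-- The relation of a state to a later state of the fusion. -/
structure Below (s s' : FusionState) : Prop where
  le : s.1 ≤ s'.1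
  level_lt : s.2.1 < s'.2.1
  bound_lt : s.2.2 < s'.2.2
  mem_tree : ∀ ν ∈ s.1.1.tree, ν.length ≤ s.2.1 → ν ∈ s'.1.1.tree
  le_meas : ∀ ν ∈ s'.1.1.tree, s.2.1 ≤ ν.length → s.2.2 ≤ s.1.1.meas ν (succs s'.1.1.tree ν)

theorem finite_level {p : LT} (hp : p.FinitelyBranching) (k : ℕ) :
    {ν | ν ∈ p.tree ∧ ν.length = k}.Finite := by
  induction k with
  | zero => exact (Set.finite_singleton []).subset fun ν hν => List.length_eq_zero_iff.1 hν.2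
  | succ k ih =>
    refine (ih.biUnion (t := fun ν => (fun n => ν ++ [n]) '' succs p.tree ν) fun ν hν =>
      (hp ν hν.1).image _).subset ?_
    rintro ν ⟨hν, hlen⟩
    rcases List.eq_nil_or_concat ν with rfl | ⟨μ, n, rfl⟩
    · simp at hlen
    · rw [List.concat_eq_append] at hν hlen ⊢
      refine Set.mem_biUnion (x := μ) ⟨p.prefix_closed _ _ hν (List.prefix_append _ _), ?_⟩
        ⟨n, hν, rfl⟩
      simpa using hlen

theorem finite_front (s : FusionState) : s.front.Finite := by
  refine ((finite_level s.1.2.1 s.2.1).biUnion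
    (t := fun ν => {d : LTfd | s.1 ≤ d ∧ d.1.tree = cone s.1.1.tree ν}) fun ν _ =>
      Set.Subsingleton.finite fun d hd d' hd' => ?_).subset ?_
  · have h : d.1.tree = d'.1.tree := hd.2.trans hd'.2.symm
    exact le_antisymm (LT.le_of_tree_subset hd.1 hd'.1 h.symm.subset)
      (LT.le_of_tree_subset hd'.1 hd.1 h.subset)
  · rintro d ⟨hd, ν, hν, hlen, h⟩
    exact Set.mem_biUnion (x := ν) ⟨hν, hlen⟩ ⟨hd, h⟩

/-- Between the two levels the later tree has the same successors as the middle one; beyond the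
second level the larger bound of the middle state applies. -/
theorem Below.trans {s s' s'' : FusionState} (h : s.Below s') (h' : s'.Below s'') :
    s.Below s'' where
  le := h.le.trans h'.le
  level_lt := h.level_lt.trans h'.level_lt
  bound_lt := h.bound_lt.trans h'.bound_lt
  mem_tree ν hν hlen := h'.mem_tree ν (h.mem_tree ν hν hlen) (hlen.trans h.level_lt.le)
  le_meas ν hν hlen := by
    rcases lt_or_ge ν.length s'.2.1 with hlt | hge
    · refine (h.le_meas ν (h'.le.1 hν) hlen).trans_eq (congrArg _ ?_)
      ext n
      exact ⟨fun hn => h'.mem_tree _ hn (by simpa using hlt), fun hn => h'.le.1 hn⟩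
    · exact (h.bound_lt.le.trans (h'.le_meas ν hν hge)).trans (LT.meas_le_of_le h.le _ _)

/-- Above the condition of a state, its front is predense. -/
theorem IsValid.predense_front {s : FusionState} (hs : s.IsValid) {r : LTfd} (hr : s.1 ≤ r) :
    ∃ d ∈ s.front, ∃ t, r ≤ t ∧ d ≤ t := by
  have hT := isSubtree_tree r
  -- Restrict both trees to a node of `r` on the level of the front. By richness both restrictions
  -- are conditions.
  obtain ⟨ν, hν, -, hlen⟩ := hT.exists_mem_length hT.nil_mem (Nat.zero_le s.2.1)
  have hd := (isSubtree_tree s.1).cone (hr.1 hν)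
  obtain ⟨d, hsd, hd'⟩ := hd.exists_condition (hs.isRich _ hd)
  have ht := hT.cone hν
  obtain ⟨t, hrt, ht'⟩ := ht.exists_condition (hs.isRich.of_le hr _ ht)
  refine ⟨d, ⟨hsd, ν, hr.1 hν, hlen, hd'⟩, t, hrt,
    LT.le_of_tree_subset hsd (hr.trans hrt) ?_⟩
  rw [ht', hd']
  exact fun μ hμ => ⟨hr.1 hμ.1, hμ.2⟩

/-- A chain with no last element has unbounded levels and bounds. The intersection of its trees then
agrees with each of them up to the respective level, so it has no terminal nodes and its norms
diverge. -/
theorem exists_upper_bound {C : Set FusionState} (hne : C.Nonempty)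
    (hvalid : ∀ s ∈ C, s.IsValid)
    (hchain : ∀ s ∈ C, ∀ s' ∈ C, s = s' ∨ s.Below s' ∨ s'.Below s) :
    ∃ q, ∀ s ∈ C, s.1 ≤ q := by
  by_cases htop : ∃ s ∈ C, ∀ s' ∈ C, ¬ s.Below s'
  · obtain ⟨s, hs, htop⟩ := htop
    refine ⟨s.1, fun s' hs' => ?_⟩
    rcases hchain s hs s' hs' with rfl | h | h
    · exact le_rfl
    · exact absurd h (htop s' hs')
    · exact h.le
  push Not at htop
  have hunb : ∀ N, ∃ s ∈ C, N ≤ s.2.1 ∧ N ≤ s.2.2 := by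
    intro N
    induction N with
    | zero => exact hne.imp fun s hs => ⟨hs, Nat.zero_le _, Nat.zero_le _⟩
    | succ N ih =>
      obtain ⟨s, hs, h1, h2⟩ := ih
      obtain ⟨s', hs', h⟩ := htop s hs
      exact ⟨s', hs', h1.trans_lt h.level_lt, h2.trans_lt h.bound_lt⟩
  let T : Set (List ℕ) := {ν | ∀ s ∈ C, ν ∈ s.1.1.tree}
  have hstab : ∀ s ∈ C, ∀ ν ∈ s.1.1.tree, ν.length ≤ s.2.1 → ν ∈ T := by
    intro s hs ν hν hlen s' hs'
    rcases hchain s hs s' hs' with rfl | h | h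
    · exact hν
    · exact h.mem_tree ν hν hlen
    · exact h.le.1 hν
  have hsucc : ∀ s ∈ C, ∀ ν : List ℕ, ν.length < s.2.1 →
      succs T ν = succs s.1.1.tree ν := by
    intro s hs ν hν
    ext n
    exact ⟨fun hn => hn s hs, fun hn => hstab s hs _ hn (by simpa using hν)⟩
  obtain ⟨s₀, hs₀⟩ := hne
  have hT : IsSubtree s₀.1.1 T :=
    { subset := fun ν hν => hν s₀ hs₀
      nil_mem := fun s _ => s.1.1.nil_mem
      prefix_closed := fun μ ν hν hμν s hs => s.1.1.prefix_closed _ _ (hν s hs) hμν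
      succs_nonempty := fun ν hν => by
        obtain ⟨s, hs, hk, -⟩ := hunb (ν.length + 1)
        rw [hsucc s hs ν hk]
        exact s.1.1.succs_nonempty ν (hν s hs)
      diverges := fun m => by
        -- The second term of the maximum rules out that `s₁` precedes `s₀`, so measures of `s₁` are
        -- bounded by those of `s₀`.
        obtain ⟨s₁, hs₁, -, hn⟩ := hunb (max m (s₀.2.2 + 1))
        have hle : s₀.1 ≤ s₁.1 := by
          rcases hchain s₀ hs₀ s₁ hs₁ with rfl | h | h
          · exact le_rfl
          · exact h.le
          · have := h.bound_lt
            omega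
        refine ⟨s₁.2.1, fun ν hν hk => ?_⟩
        -- A state whose level exceeds the length of `ν` already has the final successors of `ν`; it
        -- lies after `s₁`, whose bound therefore applies to them.
        obtain ⟨s₂, hs₂, hk₂, -⟩ := hunb (ν.length + 1)
        have hbelow : s₁.Below s₂ := by
          rcases hchain s₁ hs₁ s₂ hs₂ with rfl | h | h
          · omega
          · exact h
          · have := h.level_lt
            omega
        rw [hsucc s₂ hs₂ ν hk₂]
        exact ((le_max_left _ _).trans hn).trans
          ((hbelow.le_meas ν (hν s₂ hs₂) hk).trans (LT.meas_le_of_le hle _ _)) }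
  obtain ⟨q, hq, hqT⟩ := hT.exists_condition ((hvalid s₀ hs₀).isRich _ hT)
  refine ⟨q, fun s hs => ?_⟩
  rcases hchain s₀ hs₀ s hs with rfl | h | h
  · exact hq
  · refine LT.le_of_tree_subset h.le hq ?_
    rw [hqT]
    exact fun ν hν => hν s hs
  · exact h.le.trans hq

theorem exists_isValid {q : LTfd} (hq : IsRich q.1) : ∃ s : FusionState, s.IsValid ∧ s.1 = q := by
  obtain ⟨k, hk⟩ := q.1.exists_level q.2.1 q.2.2 1
  exact ⟨(q, k, 0), ⟨hq, hk⟩, rfl⟩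

theorem IsValid.exists_step {s : FusionState} (hs : s.IsValid) {D : Set LTfd}
    (hD : IsDenseOpen D) : ∃ s' : FusionState, s'.IsValid ∧ s.Below s' ∧ s'.front ⊆ D := by
  obtain ⟨r, K, hsr, hmem, hle, hrD⟩ := exists_pure_extension hs.isRich hD hs.lt_norm
  -- The new bound is `s.2.2 + 1`, and validity asks for norms exceeding it by 1, to pay for the
  -- next pure decision. The new level is also at least `K`, which puts the front into `D`.
  obtain ⟨k, hk⟩ := r.1.exists_level r.2.1 r.2.2 (s.2.2 + 2)
  refine ⟨(r, max (max k K) (s.2.1 + 1), s.2.2 + 1),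
    ⟨hs.isRich.of_le hsr, fun ν hν hlen => hk ν hν ?_⟩,
    ⟨hsr, lt_max_of_lt_right (Nat.lt_succ_self _), Nat.lt_succ_self _, hmem, hle⟩, ?_⟩
  · exact (le_max_left k K).trans ((le_max_left _ _).trans hlen)
  · rintro d ⟨hrd, ν, hν, hlen, hd⟩
    exact hrD d hrd ν (hlen ▸ (le_max_right k K).trans (le_max_left _ _)) hν hd

end FusionState

/-- The fusion system of `LT^f_d`; its states are the maximal conditions and the states of the
fusion of rich trees. -/
def frontSystem : FrontSystem LTfd (LTfd ⊕ FusionState) where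
  front := Sum.elim (fun q => {q}) FusionState.front
  rel
    | .inl q, .inl q' => IsMax q ∧ q = q'
    | .inr s, .inr s' => s.IsValid ∧ s'.IsValid ∧ (s = s' ∨ s.Below s')
    | _, _ => False
  finite_front
    | .inl q => Set.finite_singleton q
    | .inr s => s.finite_front
  rel_refl
    | .inl _, .inl _, ⟨h, h'⟩ => ⟨h' ▸ h, rfl⟩
    | .inr _, .inr _, ⟨_, h, _⟩ => ⟨h, h, Or.inl rfl⟩
  rel_trans
    | .inl _, .inl _, .inl _, ⟨h, h1⟩, ⟨_, h2⟩ => ⟨h, h1.trans h2⟩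
    | .inr _, .inr _, .inr _, ⟨h, _, h1⟩, ⟨_, h', h2⟩ => ⟨h, h', by
      rcases h1 with rfl | h1
      · exact h2
      · rcases h2 with rfl | h2
        · exact Or.inr h1
        · exact Or.inr (h1.trans h2)⟩
  exists_start p := by
    obtain ⟨q, hpq, hq | hq⟩ := exists_isMax_or_isRich p
    · exact ⟨.inl q, ⟨hq, rfl⟩, fun d hd => hpq.trans_eq (Set.mem_singleton_iff.1 hd).symm⟩
    · obtain ⟨s, hs, rfl⟩ := FusionState.exists_isValid hq
      exact ⟨.inr s, ⟨hs, hs, Or.inl rfl⟩, fun d hd => hpq.trans hd.1⟩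
  exists_step
    | .inl q, ⟨hq, _⟩, D, hD => by
      obtain ⟨d, hd, hqd⟩ := hD.dense q
      refine ⟨.inl q, ⟨hq, rfl⟩, Set.singleton_subset_iff.2 ?_⟩
      rwa [le_antisymm hqd (hq hqd)]
    | .inr s, ⟨hs, _⟩, D, hD => by
      obtain ⟨s', hs', hss', h⟩ := hs.exists_step hD
      exact ⟨.inr s', ⟨hs, hs', Or.inr hss'⟩, h⟩
  exists_limit := by
    rintro C ⟨s₀ | s₀, hs₀⟩ hC
    · refine ⟨s₀, ?_⟩
      rintro (s | s) hs r hr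
      · obtain rfl : s = s₀ := by
          rcases hC _ hs₀ _ hs with h | h
          · exact h.2.symm
          · exact h.2
        exact ⟨s, rfl, r, le_rfl, hr⟩
      · exact ((hC _ hs₀ _ hs).elim id id).elim
    · have hvalid : ∀ s, Sum.inr s ∈ C → s.IsValid := fun s hs => ((hC _ hs _ hs).elim id id).1
      obtain ⟨q, hq⟩ := FusionState.exists_upper_bound (C := {s | Sum.inr s ∈ C}) ⟨s₀, hs₀⟩ hvalid
        fun s hs s' hs' => by
          rcases hC _ hs _ hs' with ⟨-, -, h⟩ | ⟨-, -, h⟩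
          · exact h.imp id Or.inl
          · exact h.imp Eq.symm Or.inr
      refine ⟨q, ?_⟩
      rintro (s | s) hs r hr
      · exact ((hC _ hs₀ _ hs).elim id id).elim
      · exact (hvalid s hs).predense_front ((hq s hs).trans hr)

/-! ### Infinitely many conditions, and coding of states by conditions. -/

/-- The tree that consists of the two branches with the constant values `0` and `i + 1`. -/
def twoBranches (i : ℕ) : Set (List ℕ) := {η | ∃ a, (a = 0 ∨ a = i + 1) ∧ ∀ x ∈ η, x = a}

theorem isStem_twoBranches (i : ℕ) : IsStem (twoBranches i) [] := by
  refine ⟨⟨0, Or.inl rfl, by simp⟩, fun η _ => Or.inr List.nil_prefix,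
    0, ⟨0, Or.inl rfl, by simp⟩, i + 1, ⟨i + 1, Or.inr rfl, by simp⟩, by simp⟩

open Classical in
/-- The condition with the tree `twoBranches i` and the constant measure `|η|` at each node `η`. -/
noncomputable def twoBranchesLT (i : ℕ) : LT where
  tree := twoBranches i
  meas η S := if η ∈ ess (twoBranches i) ∧ S.Nonempty ∧ S ⊆ succs (twoBranches i) η
    then η.length else 0
  prefix_closed := fun η ν ⟨a, ha, h⟩ hην => ⟨a, ha, fun x hx => h x (hην.subset hx)⟩
  succs_nonempty := fun η ⟨a, ha, h⟩ => ⟨a, a, ha, fun x hx => by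
    rcases List.mem_append.1 hx with hx | hx
    · exact h x hx
    · exact List.mem_singleton.1 hx⟩
  exists_stem := ⟨[], isStem_twoBranches i⟩
  isLogMeasure η hη := by
    constructor
    · intro x y hx hxy hy
      rw [if_pos ⟨hη, hx, hxy.trans hy⟩, if_pos ⟨hη, hx.mono hxy, hy⟩]
    · intro x y hx hy hx' hy'
      rw [if_pos ⟨hη, hx.mono Set.subset_union_left, Set.union_subset hx' hy'⟩,
        if_pos ⟨hη, hx, hx'⟩]
      exact Or.inl (Nat.le_succ _)
  meas_eq_zero η S h := if_neg h

theorem norm_twoBranchesLT {i : ℕ} {η : List ℕ} (hη : η ∈ twoBranches i) :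
    (twoBranchesLT i).norm η = η.length :=
  if_pos ⟨⟨hη, [], isStem_twoBranches i, List.nil_prefix⟩,
    (twoBranchesLT i).succs_nonempty η hη, subset_rfl⟩

theorem finitelyBranching_twoBranchesLT (i : ℕ) : (twoBranchesLT i).FinitelyBranching := by
  intro η _
  refine (Set.toFinite {0, i + 1}).subset ?_
  rintro n ⟨a, ha, h⟩
  rw [h n (by simp)]
  exact ha

theorem divergent_twoBranchesLT (i : ℕ) : (twoBranchesLT i).Divergent := by
  intro m x hx
  refine (Set.finite_range fun j : Fin m => (List.range j).map x).subset ?_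
  rintro _ ⟨⟨k, rfl⟩, hk⟩
  refine ⟨⟨k, ?_⟩, rfl⟩
  by_contra! hle
  refine hk ⟨hx k, fun ν hν hpre => ?_⟩
  rw [norm_twoBranchesLT hν]
  exact hle.trans (by simpa using hpre.length_le)

instance infinite_LTfd : Infinite LTfd := by
  refine Infinite.of_injective (fun i : ℕ =>
    (⟨twoBranchesLT i, finitelyBranching_twoBranchesLT i, divergent_twoBranchesLT i⟩ : LTfd)) ?_
  intro i j h
  have hT : twoBranches i = twoBranches j := congrArg (fun p : LTfd => p.1.tree) h
  have hi : [i + 1] ∈ twoBranches j := hT ▸ ⟨i + 1, Or.inr rfl, by simp⟩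
  obtain ⟨a, ha, h⟩ := hi
  have := h (i + 1) (by simp)
  omega

/-- Serves to index the fusion states by conditions, as the coding in V_κ requires. -/
theorem nonempty_equiv_sum (P : Type) [Infinite P] : Nonempty (P ≃ P ⊕ P × ℕ × ℕ) := by
  rw [← Cardinal.eq]
  have h := Cardinal.aleph0_le_mk P
  rw [Cardinal.mk_sum, Cardinal.lift_id, Cardinal.lift_id, Cardinal.mk_prod, Cardinal.lift_id,
    Cardinal.lift_id, Cardinal.mk_eq_aleph0 (ℕ × ℕ), Cardinal.mul_aleph0_eq h,
    Cardinal.add_eq_self h]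

end LTForcing

theorem proposition1p18 :
    LTForcing.IsOmegaOmegaBounding LTForcing.LTfd ∧ LTForcing.IsProperForcing LTForcing.LTfd := by
  obtain ⟨e⟩ := LTForcing.nonempty_equiv_sum LTForcing.LTfd
  exact ⟨LTForcing.frontSystem.isOmegaOmegaBounding,
    (LTForcing.frontSystem.reindex e).isProperForcing⟩
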